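/- Let $n$ be a positive integer coprime with $6$, and let $a$ and $q$ be indeterminates. Put $(x;q)_k=\prod_{j=0}^{k-1}(1-xq^j)$ and $[m]=(1-q^m)/(1-q)=1+q+\dots+q^{m-1}$, and let $\left(\frac{-3}{n}\right)$ denote the Jacobi--Kronecker symbol. For rational functions $A,B\in\mathbb Z(a,q)$ and a polynomial $P\in\mathbb Z[a,q]$, the congruence $A\equiv B\pmod P$ means that $A-B=A_1/A_2$ for some polynomials $A_1,A_2\in\mathbb Z[a,q]$, $A_2\neq0$, such that $P$ divides $A_1$ and $P$ is coprime with $A_2$ (no common divisors other than units). Then $$ \sum_{k=0}^{n-1}\frac{(aq;q^2)_k\,(q/a;q^2)_k\,(q;q^2)_{2k}}{(q^2;q^2)_{2k}\,(aq^6;q^6)_k\,(q^6/a;q^6)_k}\,[8k+1]\,q^{2k^2} \equiv q^{-(n-1)/2}[n]\left(\frac{-3}{n}\right) \pmod{[n](1-aq^n)(a-q^n)}. $$ -/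

import Mathlib

open scoped Polynomial.Bivariate NumberTheorySymbols

/-- The `q`-Pochhammer symbol `(x; q)_k = ∏_{j=0}^{k-1} (1 - x q^j)`. -/
def qPochhammer {R : Type*} [CommRing R] (x q : R) (k : ℕ) : R :=
  ∏ j ∈ Finset.range k, (1 - x * q ^ j)

/-- The `q`-number `[n] = (1 - q^n) / (1 - q)`, written as the polynomial `1 + q + ⋯ + q^(n-1)` so
that it makes sense in every commutative ring. -/
def qNumber {R : Type*} [CommRing R] (q : R) (n : ℕ) : R :=
  ∑ i ∈ Finset.range n, q ^ i

/-- In a field, `[n]` is the quotient `(1 - q^n) / (1 - q)`. -/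
theorem qNumber_eq_div {K : Type*} [Field K] {q : K} (hq : q ≠ 1) (n : ℕ) :
    qNumber q n = (1 - q ^ n) / (1 - q) := by
  have h : (1 : K) - q ≠ 0 := sub_ne_zero.mpr hq.symm
  rw [eq_div_iff h]
  exact geom_sum_mul_neg q n

/-- Congruence of two fractions over a domain `R` modulo `P ∈ R`: the difference `A - B` can be
written as `A₁ / A₂` with `A₁, A₂ ∈ R`, where `P` divides `A₁` and `P` is coprime with `A₂`
(that is, they have no common divisors other than units). -/
def FracModEq {R : Type*} [CommRing R] [IsDomain R] (P : R) (A B : FractionRing R) : Prop :=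
  ∃ A₁ A₂ : R, A₂ ≠ 0 ∧
    A - B = algebraMap R (FractionRing R) A₁ / algebraMap R (FractionRing R) A₂ ∧
    P ∣ A₁ ∧ IsRelPrime P A₂

namespace TwoIndeterminates

/-- The indeterminate `q` in `ℤ[q][a]`. -/
noncomputable def q : ℤ[X][Y] := Polynomial.C Polynomial.X

/-- The indeterminate `a` in `ℤ[q][a]`. -/
noncomputable def a : ℤ[X][Y] := Polynomial.X

/-- The field `ℤ(a, q)` of rational functions in `a` and `q`. -/
abbrev RationalFunctions : Type := FractionRing ℤ[X][Y]

/-- The indeterminate `q` as a rational function. -/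
noncomputable def q' : RationalFunctions := algebraMap ℤ[X][Y] RationalFunctions q

/-- The indeterminate `a` as a rational function. -/
noncomputable def a' : RationalFunctions := algebraMap ℤ[X][Y] RationalFunctions a

end TwoIndeterminates

/-- The `a`-deformed truncated sum
`∑_{k=0}^{n-1} (aq;q²)_k (q/a;q²)_k (q;q²)_{2k} / ((q²;q²)_{2k} (aq⁶;q⁶)_k (q⁶/a;q⁶)_k) [8k+1] q^{2k²}`
for elements `a`, `q` of a field. -/
def deformedSum {K : Type*} [Field K] (a q : K) (n : ℕ) : K :=
  ∑ k ∈ Finset.range n,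
    qPochhammer (a * q) (q ^ 2) k * qPochhammer (q / a) (q ^ 2) k *
        qPochhammer q (q ^ 2) (2 * k) /
      (qPochhammer (q ^ 2) (q ^ 2) (2 * k) * qPochhammer (a * q ^ 6) (q ^ 6) k *
        qPochhammer (q ^ 6 / a) (q ^ 6) k) *
      qNumber q (8 * k + 1) * q ^ (2 * k ^ 2)

/-! ### Elementary identities for `q`-Pochhammer symbols. -/

section Pochhammer

variable {R : Type*} [CommRing R]

/-! The summand is embedded in a family with an extra parameter `u`, specialised at the end to `u =
q`. A telescoping certificate relates the sums at `u` and `u q⁶` (`sum_cubicTerm_contiguous`), and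
this one relation yields both halves of the congruence.

Modulo `1 - a q^n` or `a - q^n`, the symmetry `a ↔ 1/a` allows `a = q^(-n)`, where the series
terminates. The relation then determines the sum at `u = q^(-2-6j)` from its one-term value at `u =
q^(-2)`. These are infinitely many points and the sum is rational in `u`, so a product formula holds
for every admissible `u` (`sum_cubicTerm_eq_qPochhammer`). At `u = q` it collapses to the right-hand
side, the residue of `n` modulo 6 giving the sign.

Modulo `Φ_d(q)` with `d ∣ n`, `d > 1`, the right-hand side vanishes, and each block of `d`
consecutive terms must sum to 0 at a primitive `d`-th root of unity. With `d = 2N + 1`, the value `u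
= ζ` satisfies `u ζ^(2N) = 1`; the relation lowers `N` by 3 until a factor vanishes, which works
because `3 ∤ d` (`sum_cubicTerm_eq_zero`, `sum_deformedTerm_eq_zero`).

Each modulus generates the kernel of a homomorphism to a field, so each congruence is an equality of
values there. The moduli are pairwise coprime and `[n]` is the product of these `Φ_d(q)`, so unique
factorisation combines the congruences. -/

theorem qPochhammer_zero (x q : R) : qPochhammer x q 0 = 1 := by
  simp [qPochhammer]

theorem qPochhammer_succ (x q : R) (k : ℕ) :
    qPochhammer x q (k + 1) = qPochhammer x q k * (1 - x * q ^ k) := by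
  simp [qPochhammer, Finset.prod_range_succ]

theorem qPochhammer_add (x q : R) (k l : ℕ) :
    qPochhammer x q (k + l) = qPochhammer x q k * qPochhammer (x * q ^ k) q l := by
  simp only [qPochhammer, Finset.prod_range_add]
  congr 1
  exact Finset.prod_congr rfl fun i _ => by ring

theorem qPochhammer_succ' (x q : R) (k : ℕ) :
    qPochhammer x q (k + 1) = (1 - x) * qPochhammer (x * q) q k := by
  rw [add_comm, qPochhammer_add, qPochhammer_succ, qPochhammer_zero]
  simp

theorem map_qPochhammer {S : Type*} [CommRing S] (f : R →+* S) (x q : R) (k : ℕ) :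
    f (qPochhammer x q k) = qPochhammer (f x) (f q) k := by
  simp [qPochhammer]

theorem qPochhammer_ne_zero [IsDomain R] {x q : R} {k : ℕ}
    (h : ∀ i < k, 1 - x * q ^ i ≠ 0) : qPochhammer x q k ≠ 0 :=
  Finset.prod_ne_zero_iff.mpr fun i hi => h i (Finset.mem_range.mp hi)

theorem qPochhammer_eq_zero {x q : R} {k i : ℕ} (hi : i < k) (h : x * q ^ i = 1) :
    qPochhammer x q k = 0 :=
  Finset.prod_eq_zero (Finset.mem_range.mpr hi) (by rw [h, sub_self])

end Pochhammer

/-! ### The cubic series and its contiguous relation `u → u s⁶`. -/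

section CubicSum

variable {K : Type*} [Field K]

/-- The summand of the cubic basic hypergeometric series, with its index shifted by the `s²`-adic
logarithm of `y`. -/
def cubicTerm (a b s y u : K) (k : ℕ) : K :=
  qPochhammer (a * s * y) (s ^ 2) k * qPochhammer (b * s * y) (s ^ 2) k *
      qPochhammer (u * y ^ 2) (s ^ 2) (2 * k) * (1 - u * y ^ 4 * s ^ (8 * k)) *
      (s ^ (2 * k ^ 2) * y ^ (2 * k)) /
    (qPochhammer (s ^ 2 * y ^ 2) (s ^ 2) (2 * k) *
      qPochhammer (a * u * s ^ 5 * y ^ 3) (s ^ 6) k *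
      qPochhammer (b * u * s ^ 5 * y ^ 3) (s ^ 6) k)

/-- The antidifference that certifies the contiguous relation of the cubic series in `u`. -/
def cubicCertificate (a b s y u : K) (k : ℕ) : K :=
  u * s ^ 2 * (qPochhammer (a * s * y) (s ^ 2) (k + 1) *
      qPochhammer (b * s * y) (s ^ 2) (k + 1) *
      qPochhammer (u * y ^ 2) (s ^ 2) (2 * k + 2) *
      (s ^ (2 * (k + 1) ^ 2) * y ^ (2 * (k + 1)))) /
    (qPochhammer (s ^ 2 * y ^ 2) (s ^ 2) (2 * k) *
      qPochhammer (a * u * s ^ 11 * y ^ 3) (s ^ 6) k *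
      qPochhammer (b * u * s ^ 11 * y ^ 3) (s ^ 6) k)

/-- This is the telescoping step with all common Pochhammer factors removed; `x` stands for `y
s^(2k)`, so one polynomial identity serves every index. -/
theorem cubic_certificate_identity {R : Type*} [CommRing R] {a b : R} (hab : a * b = 1)
    (s u x : R) :
    u * s ^ 4 * x ^ 2 * ((1 - a * s * x) * (1 - b * s * x) * (1 - u * x ^ 2) *
        (1 - u * s ^ 2 * x ^ 2)) -
      u * ((1 - x ^ 2) * (s ^ 2 - x ^ 2) * (1 - a * u * s ^ 5 * x ^ 3) *
        (1 - b * u * s ^ 5 * x ^ 3)) =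
    (1 - u * x ^ 4) * (1 - u * s ^ 2) * (1 - a * u * s ^ 5 * x ^ 3) *
        (1 - b * u * s ^ 5 * x ^ 3) -
      (1 - u * x ^ 2) * (1 - u * s ^ 2 * x ^ 2) * (1 - u * s ^ 4 * x ^ 2) *
        (1 - u * s ^ 6 * x ^ 4) := by
  linear_combination (u * s ^ 6 * x ^ 4 * (1 - u * x ^ 2) * (1 - u * s ^ 2 * x ^ 2) -
    u * (1 - x ^ 2) * (s ^ 2 - x ^ 2) * u ^ 2 * s ^ 10 * x ^ 6 -
    (1 - u * x ^ 4) * (1 - u * s ^ 2) * u ^ 2 * s ^ 10 * x ^ 6) * hab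

/-- Both sides split a product of length `m + 3`, at either end. For `p = s²` this absorbs the shift
of `u` by `s⁶`. -/
theorem qPochhammer_shift_three {R : Type*} [CommRing R] (x p : R) (m : ℕ) :
    (1 - x) * (1 - x * p) * (1 - x * p ^ 2) * qPochhammer (x * p ^ 3) p m =
      qPochhammer x p m * ((1 - x * p ^ m) * (1 - x * p ^ (m + 1)) * (1 - x * p ^ (m + 2))) := by
  have h : (1 - x) * (1 - x * p) * (1 - x * p ^ 2) = qPochhammer x p 3 := by
    simp [qPochhammer, Finset.prod_range_succ]
  rw [h, ← qPochhammer_add, add_comm, qPochhammer_add]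
  congr 1
  simp only [qPochhammer, Finset.prod_range_succ, Finset.prod_range_zero]
  ring

/-- The combination of summands is a difference of consecutive certificates. The lower boundary term
carries the factor `(1 - y²)(s² - y²)`, so `hy` says exactly where summation may start without
leaving a remainder: `y² = 1` or `y² = s²`. -/
theorem sum_cubicTerm_contiguous {a b s y u : K} (hab : a * b = 1)
    (hy : (1 - y ^ 2) * (s ^ 2 - y ^ 2) = 0) (M : ℕ)
    (hq : qPochhammer (s ^ 2 * y ^ 2) (s ^ 2) (2 * M) ≠ 0)
    (ha : qPochhammer (a * u * s ^ 5 * y ^ 3) (s ^ 6) (M + 1) ≠ 0)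
    (hb : qPochhammer (b * u * s ^ 5 * y ^ 3) (s ^ 6) (M + 1) ≠ 0) :
    (1 - u * s ^ 2) * (1 - a * u * s ^ 5 * y ^ 3) * (1 - b * u * s ^ 5 * y ^ 3) *
        ∑ k ∈ Finset.range (M + 1), cubicTerm a b s y u k -
      (1 - u * y ^ 2) * (1 - u * s ^ 2 * y ^ 2) * (1 - u * s ^ 4 * y ^ 2) *
        ∑ k ∈ Finset.range (M + 1), cubicTerm a b s y (u * s ^ 6) k =
    cubicCertificate a b s y u M := by
  induction M with
  | zero =>
    have h := cubic_certificate_identity hab s u y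
    simp only [cubicTerm, cubicCertificate, qPochhammer, zero_add, Finset.sum_range_one,
      Finset.prod_range_succ, Finset.prod_range_zero, mul_zero, pow_zero, one_mul, mul_one, div_one]
    linear_combination -h - u * (1 - a * u * s ^ 5 * y ^ 3) * (1 - b * u * s ^ 5 * y ^ 3) * hy
  | succ M ih =>
    rw [Finset.sum_range_succ _ (M + 1), Finset.sum_range_succ _ (M + 1)]
    have e2 : 2 * (M + 1) = 2 * M + 1 + 1 := by ring
    rw [e2, qPochhammer_succ, qPochhammer_succ] at hq
    rw [qPochhammer_succ] at ha hb
    have hq0 := left_ne_zero_of_mul (left_ne_zero_of_mul hq)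
    have hq1 := right_ne_zero_of_mul (left_ne_zero_of_mul hq)
    have hq2 := right_ne_zero_of_mul hq
    have ha0 := left_ne_zero_of_mul ha
    have ha1 := right_ne_zero_of_mul ha
    have hb0 := left_ne_zero_of_mul hb
    have hb1 := right_ne_zero_of_mul hb
    have ih := ih hq0 ha0 hb0
    rw [qPochhammer_succ'] at ha0 hb0
    have ha2 := left_ne_zero_of_mul ha0
    have ha3 := right_ne_zero_of_mul ha0
    have hb2 := left_ne_zero_of_mul hb0
    have hb3 := right_ne_zero_of_mul hb0
    have key := cubic_certificate_identity hab s u (y * s ^ (2 * (M + 1)))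
    have sh := qPochhammer_shift_three (u * y ^ 2) (s ^ 2) (2 * M + 2)
    suffices h :
        (1 - u * s ^ 2) * (1 - a * u * s ^ 5 * y ^ 3) * (1 - b * u * s ^ 5 * y ^ 3) *
          cubicTerm a b s y u (M + 1) -
        (1 - u * y ^ 2) * (1 - u * s ^ 2 * y ^ 2) * (1 - u * s ^ 4 * y ^ 2) *
          cubicTerm a b s y (u * s ^ 6) (M + 1) =
        cubicCertificate a b s y u (M + 1) - cubicCertificate a b s y u M by
      linear_combination h + ih
    have r1 : a * u * s ^ 5 * y ^ 3 * s ^ 6 = a * u * s ^ 11 * y ^ 3 := by ring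
    have r2 : b * u * s ^ 5 * y ^ 3 * s ^ 6 = b * u * s ^ 11 * y ^ 3 := by ring
    have r3 : a * (u * s ^ 6) * s ^ 5 * y ^ 3 = a * u * s ^ 11 * y ^ 3 := by ring
    have r4 : b * (u * s ^ 6) * s ^ 5 * y ^ 3 = b * u * s ^ 11 * y ^ 3 := by ring
    have r5 : u * s ^ 6 * y ^ 2 = u * y ^ 2 * (s ^ 2) ^ 3 := by ring
    rw [r1] at ha3
    rw [r2] at hb3
    have e3 : 2 * (M + 1) + 2 = 2 * M + 2 + 1 + 1 := by ring
    have e4 : 2 * (M + 1) = 2 * M + 2 := by ring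
    unfold cubicTerm cubicCertificate
    rw [r3, r4, r5, e3, e4]
    rw [qPochhammer_succ (a * s * y) _ (M + 1), qPochhammer_succ (b * s * y) _ (M + 1),
      qPochhammer_succ (u * y ^ 2) _ (2 * M + 2 + 1), qPochhammer_succ (u * y ^ 2) _ (2 * M + 2),
      show qPochhammer (s ^ 2 * y ^ 2) (s ^ 2) (2 * M + 2) = _ from
        qPochhammer_succ (s ^ 2 * y ^ 2) (s ^ 2) (2 * M + 1),
      qPochhammer_succ (s ^ 2 * y ^ 2) (s ^ 2) (2 * M),
      qPochhammer_succ' (a * u * s ^ 5 * y ^ 3), qPochhammer_succ' (b * u * s ^ 5 * y ^ 3), r1, r2,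
      qPochhammer_succ (a * u * s ^ 11 * y ^ 3) _ M, qPochhammer_succ (b * u * s ^ 11 * y ^ 3) _ M]
    have ha4 : 1 - a * u * s ^ 11 * y ^ 3 * (s ^ 6) ^ M ≠ 0 := by
      convert ha1 using 2; ring
    have hb4 : 1 - b * u * s ^ 11 * y ^ 3 * (s ^ 6) ^ M ≠ 0 := by
      convert hb1 using 2; ring
    set W := qPochhammer (u * y ^ 2) (s ^ 2) (2 * M + 2)
    set W3 := qPochhammer (u * y ^ 2 * (s ^ 2) ^ 3) (s ^ 2) (2 * M + 2)
    set Pa := qPochhammer (a * s * y) (s ^ 2) (M + 1)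
    set Pb := qPochhammer (b * s * y) (s ^ 2) (M + 1)
    set Q := qPochhammer (s ^ 2 * y ^ 2) (s ^ 2) (2 * M)
    set Da := qPochhammer (a * u * s ^ 11 * y ^ 3) (s ^ 6) M
    set Db := qPochhammer (b * u * s ^ 11 * y ^ 3) (s ^ 6) M
    have hE : s ^ (2 * (M + 1 + 1) ^ 2) * y ^ (2 * (M + 1 + 1)) =
        s ^ (2 * (M + 1) ^ 2) * y ^ (2 * M + 2) * (s ^ 2 * (y * s ^ (2 * (M + 1))) ^ 2) := by ring
    rw [hE]
    set E := s ^ (2 * (M + 1) ^ 2) * y ^ (2 * M + 2)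
    -- In terms of `X`, every factor gained in passing to index `M + 1` takes the form occurring in
    -- `cubic_certificate_identity`.
    set X := y * s ^ (2 * (M + 1)) with hX
    have f1 : u * y ^ 4 * s ^ (8 * (M + 1)) = u * X ^ 4 := by rw [hX]; ring
    have f2 : u * s ^ 6 * y ^ 4 * s ^ (8 * (M + 1)) = u * s ^ 6 * X ^ 4 := by rw [hX]; ring
    have f3 : a * s * y * (s ^ 2) ^ (M + 1) = a * s * X := by rw [hX]; ring
    have f4 : b * s * y * (s ^ 2) ^ (M + 1) = b * s * X := by rw [hX]; ring
    have f5 : u * y ^ 2 * (s ^ 2) ^ (2 * M + 2) = u * X ^ 2 := by rw [hX]; ring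
    have f6 : u * y ^ 2 * (s ^ 2) ^ (2 * M + 2 + 1) = u * s ^ 2 * X ^ 2 := by rw [hX]; ring
    have f7 : u * y ^ 2 * (s ^ 2) ^ (2 * M + 2 + 2) = u * s ^ 4 * X ^ 2 := by rw [hX]; ring
    have f8 : a * u * s ^ 11 * y ^ 3 * (s ^ 6) ^ M = a * u * s ^ 5 * X ^ 3 := by rw [hX]; ring
    have f9 : b * u * s ^ 11 * y ^ 3 * (s ^ 6) ^ M = b * u * s ^ 5 * X ^ 3 := by rw [hX]; ring
    have g1 : s ^ 2 * y ^ 2 * (s ^ 2) ^ (2 * M + 1) = X ^ 2 := by rw [hX]; ring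
    -- The prefactor `s²` of the certificate clears the denominator in `1 - X² / s²`.
    have g2 : s ^ 2 * (1 - s ^ 2 * y ^ 2 * (s ^ 2) ^ (2 * M)) = s ^ 2 - X ^ 2 := by
      rw [hX]; ring
    have g3 : u * y ^ 2 * s ^ 2 = u * s ^ 2 * y ^ 2 := by ring
    have g4 : u * y ^ 2 * (s ^ 2) ^ 2 = u * s ^ 4 * y ^ 2 := by ring
    rw [f8] at ha4
    rw [f9] at hb4
    rw [g1] at hq2
    rw [g3, g4, f5, f6, f7] at sh
    rw [f1, f2, f3, f4, f5, f6, f8, f9, g1]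
    generalize (1 - s ^ 2 * y ^ 2 * (s ^ 2) ^ (2 * M)) = q1 at *
    generalize (1 - a * u * s ^ 5 * y ^ 3) = a2 at *
    generalize (1 - b * u * s ^ 5 * y ^ 3) = b2 at *
    generalize 1 - a * u * s ^ 5 * X ^ 3 = a4 at *
    generalize 1 - b * u * s ^ 5 * X ^ 3 = b4 at *
    generalize (1 - X ^ 2) = q2 at *
    have t1 : (1 - u * s ^ 2) * a2 * b2 * (Pa * Pb * W * (1 - u * X ^ 4) * E /
        (Q * q1 * q2 * (a2 * Da) * (b2 * Db))) =
        Pa * Pb * W * E * ((1 - u * s ^ 2) * (1 - u * X ^ 4) * a4 * b4) /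
          (Q * q1 * q2 * (Da * a4) * (Db * b4)) := by
      field_simp
    have t2 : (1 - u * y ^ 2) * (1 - u * s ^ 2 * y ^ 2) * (1 - u * s ^ 4 * y ^ 2) *
        (Pa * Pb * W3 * (1 - u * s ^ 6 * X ^ 4) * E / (Q * q1 * q2 * (Da * a4) * (Db * b4))) =
        Pa * Pb * W * E * ((1 - u * X ^ 2) * (1 - u * s ^ 2 * X ^ 2) * (1 - u * s ^ 4 * X ^ 2) *
          (1 - u * s ^ 6 * X ^ 4)) / (Q * q1 * q2 * (Da * a4) * (Db * b4)) := by
      rw [← mul_div_assoc]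
      congr 1
      linear_combination Pa * Pb * (1 - u * s ^ 6 * X ^ 4) * E * sh
    have t3 : u * s ^ 2 * (Pa * Pb * W * E) / (Q * Da * Db) =
        Pa * Pb * W * E * (u * (q2 * (s ^ 2 * q1) * a4 * b4)) /
          (Q * q1 * q2 * (Da * a4) * (Db * b4)) := by
      field_simp
    rw [t1, t2, t3, ← sub_div, ← sub_div, g2]
    congr 1
    linear_combination -Pa * Pb * W * E * key

end CubicSum

/-! ### Vanishing of the cubic sum when `u s^(2N) = 1`. -/

section CubicSumVanishing

variable {K : Type*} [Field K]

theorem cubicTerm_eq_zero_of_mul_eq_one {a b s y u : K} (hy : y ^ 2 = 1) (hu : u = 1) (k : ℕ) :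
    cubicTerm a b s y u k = 0 := by
  subst hu
  rcases k with _ | k
  · have : y ^ 4 = 1 := by rw [show 4 = 2 * 2 from rfl, pow_mul, hy, one_pow]
    simp [cubicTerm, this]
  · have : qPochhammer (1 * y ^ 2) (s ^ 2) (2 * (k + 1)) = 0 :=
      qPochhammer_eq_zero (i := 0) (by omega) (by simp [hy])
    rw [cubicTerm, this]
    simp

/-- The upper certificate contains a zero factor, so the contiguous relation passes from `N` to `N -
3`, ending at `N = 2` or `N = 3`. The class `N ≡ 1` modulo 3 is excluded because it would descend to
`N = 1`, where the coefficient `1 - u s²` vanishes. -/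
theorem sum_cubicTerm_eq_zero {a b s y : K} (hab : a * b = 1)
    (hy : y ^ 2 = 1 ∨ y ^ 2 = s ^ 2) (M : ℕ)
    (hq : qPochhammer (s ^ 2 * y ^ 2) (s ^ 2) (2 * M) ≠ 0)
    (ha : ∀ (N : ℕ) (u : K), u * s ^ (2 * N) = 1 → ∀ i : ℕ, a * u * s ^ 5 * y ^ 3 * (s ^ 6) ^ i ≠ 1)
    (hb : ∀ (N : ℕ) (u : K), u * s ^ (2 * N) = 1 → ∀ i : ℕ, b * u * s ^ 5 * y ^ 3 * (s ^ 6) ^ i ≠ 1)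
    (N : ℕ) (hN2 : 2 ≤ N) (hNM : N ≤ 2 * M + 1) (hN3 : N % 3 ≠ 1)
    (hs : ∀ j, 1 ≤ j → j < N → s ^ (2 * j) ≠ 1) (u : K) (hu : u * s ^ (2 * N) = 1) :
    ∑ k ∈ Finset.range (M + 1), cubicTerm a b s y u k = 0 := by
  induction N using Nat.strong_induction_on generalizing u with
  | _ N ih =>
  have hy' : (1 - y ^ 2) * (s ^ 2 - y ^ 2) = 0 := by
    rcases hy with h | h <;> simp [h]
  have h1 : 1 - u * s ^ 2 ≠ 0 := by
    intro h
    refine hs (N - 1) (by omega) (by omega) ?_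
    have e : 2 * N = 2 + 2 * (N - 1) := by omega
    rw [e, pow_add, ← mul_assoc, ← sub_eq_zero.mp h, one_mul] at hu
    exact hu
  have h2 : 1 - a * u * s ^ 5 * y ^ 3 ≠ 0 :=
    sub_ne_zero.mpr fun h => ha N u hu 0 (by rw [pow_zero, mul_one]; exact h.symm)
  have h3 : 1 - b * u * s ^ 5 * y ^ 3 ≠ 0 :=
    sub_ne_zero.mpr fun h => hb N u hu 0 (by rw [pow_zero, mul_one]; exact h.symm)
  have key := sum_cubicTerm_contiguous (u := u) hab hy' M hq
    (qPochhammer_ne_zero fun i _ => sub_ne_zero.mpr (ha N u hu i).symm)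
    (qPochhammer_ne_zero fun i _ => sub_ne_zero.mpr (hb N u hu i).symm)
  have hW : qPochhammer (u * y ^ 2) (s ^ 2) (2 * M + 2) = 0 := by
    rcases hy with h | h
    · refine qPochhammer_eq_zero (i := N) (by omega) ?_
      rw [h, mul_one, ← pow_mul, hu]
    · refine qPochhammer_eq_zero (i := N - 1) (by omega) ?_
      rw [h, ← pow_mul, mul_assoc, ← pow_add, show 2 + 2 * (N - 1) = 2 * N by omega, hu]
  have hH : cubicCertificate a b s y u M = 0 := by simp [cubicCertificate, hW]
  have hc : (1 - u * y ^ 2) * (1 - u * s ^ 2 * y ^ 2) * (1 - u * s ^ 4 * y ^ 2) *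
      ∑ k ∈ Finset.range (M + 1), cubicTerm a b s y (u * s ^ 6) k = 0 := by
    -- In the base cases a coefficient on the shifted sum vanishes, except for `N = 3`, `y² = 1`,
    -- where the shifted parameter is 1 and every term is zero.
    rcases Nat.lt_or_ge N 4 with h4 | h4
    · obtain rfl | rfl : N = 2 ∨ N = 3 := by omega
      · have : (1 - u * s ^ 2 * y ^ 2) * (1 - u * s ^ 4 * y ^ 2) = 0 := by
          rcases hy with h | h
          · rw [h]; linear_combination (1 - u * s ^ 2) * -hu
          · rw [h]; linear_combination (1 - u * s ^ 6) * -hu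
        linear_combination (1 - u * y ^ 2) *
          (∑ k ∈ Finset.range (M + 1), cubicTerm a b s y (u * s ^ 6) k) * this
      · rcases hy with h | h
        · rw [Finset.sum_eq_zero fun k _ => cubicTerm_eq_zero_of_mul_eq_one h hu k, mul_zero]
        · have : 1 - u * s ^ 4 * y ^ 2 = 0 := by rw [h]; linear_combination -hu
          rw [this]; ring
    · have h5 : 2 ≤ N - 3 := by omega
      rw [ih (N - 3) (by omega) h5 (by omega) (by omega) (fun j hj hj' => hs j hj (by omega))
        (u * s ^ 6) ?_, mul_zero]
      rw [mul_assoc, ← pow_add, show 6 + 2 * (N - 3) = 2 * N by omega, hu]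
  rw [hH, hc, sub_zero] at key
  exact (mul_eq_zero.mp key).resolve_left (mul_ne_zero (mul_ne_zero h1 h2) h3)

end CubicSumVanishing

/-! ### Product formula for the terminating cubic series. -/

section CubicSumEvaluation

variable {K : Type*} [Field K]

/-- As `s` is not a root of unity, this reduces the nonvanishing of denominators to arithmetic of
exponents. -/
theorem eq_of_pow_mul_pow_eq_one {r s : K} (hrs : r * s = 1) (hs : ∀ i, 0 < i → s ^ i ≠ 1)
    {i l : ℕ} (h : s ^ i * r ^ l = 1) : i = l := by
  have hs0 : s ≠ 0 := right_ne_zero_of_mul_eq_one hrs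
  have hr0 : r ≠ 0 := left_ne_zero_of_mul_eq_one hrs
  rcases lt_trichotomy i l with hl | hl | hl
  · exfalso
    obtain ⟨c, rfl⟩ := Nat.exists_eq_add_of_lt hl
    refine hs (c + 1) (by omega) ?_
    have e : s ^ i * r ^ (i + c + 1) * s ^ (c + 1) = s ^ (c + 1) := by rw [h, one_mul]
    rw [← e, show s ^ i * r ^ (i + c + 1) * s ^ (c + 1) = (r * s) ^ (i + c + 1) by ring, hrs,
      one_pow]
  · exact hl
  · exfalso
    obtain ⟨c, rfl⟩ := Nat.exists_eq_add_of_lt hl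
    refine hs (c + 1) (by omega) ?_
    rw [show s ^ (l + c + 1) * r ^ l = s ^ (c + 1) * (r * s) ^ l by ring, hrs, one_pow,
      mul_one] at h
    exact h

/-- Along the points `u s^(2 + 6 j) = 1`, the terminating cubic series is given by a product. -/
theorem sum_cubicTerm_mul_qPochhammer {a b s r : K} (hab : a * b = 1) (hrs : r * s = 1)
    (hs : ∀ i, 0 < i → s ^ i ≠ 1) (M m e₁ e₂ : ℕ)
    (he : e₁ = 4 ∧ e₂ = 0 ∨ e₁ = 0 ∧ e₂ = 4)
    (hM : a * s * s ^ (2 * M) = 1)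
    (ha : a * s ^ 5 = s ^ e₁ * r ^ (6 * m)) (hb : b * s ^ 5 = s ^ (e₂ + 6 * m + 6))
    (j : ℕ) :
    (∑ k ∈ Finset.range (M + 1), cubicTerm a b s 1 (r ^ (2 + 6 * j)) k) *
        qPochhammer (r ^ (2 + 6 * j) * s ^ e₁ * r ^ 6) (r ^ 6) m *
        qPochhammer (r ^ 2 * s ^ e₂) (s ^ 6) (m + 1) =
      (1 - r ^ 2) * qPochhammer (r ^ 2 * s ^ e₁ * r ^ 6) (r ^ 6) m *
        qPochhammer (r ^ (2 + 6 * j) * s ^ e₂) (s ^ 6) (m + 1) := by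
  induction j with
  | zero =>
    -- At `u = s^(-2)` the factor `1 - u s²` kills every term but the first.
    have h : ∑ k ∈ Finset.range (M + 1), cubicTerm a b s 1 (r ^ (2 + 6 * 0)) k = 1 - r ^ 2 := by
      rw [Finset.sum_range_succ', Finset.sum_eq_zero, zero_add]
      · simp [cubicTerm, qPochhammer_zero]
      · intro k _
        have : qPochhammer (r ^ (2 + 6 * 0) * 1 ^ 2) (s ^ 2) (2 * (k + 1)) = 0 := by
          refine qPochhammer_eq_zero (i := 1) (by omega) ?_
          linear_combination (r * s + 1) * hrs
        rw [cubicTerm, this]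
        simp
    rw [h]
  | succ j ih =>
    set u := r ^ (2 + 6 * (j + 1)) with hu
    have hus : r ^ (2 + 6 * j) = u * s ^ 6 := by
      rw [hu, show r ^ (2 + 6 * (j + 1)) * s ^ 6 = r ^ (2 + 6 * j) * (r * s) ^ 6 by ring, hrs,
        one_pow, mul_one]
    rw [hus] at ih
    have hq : qPochhammer (s ^ 2 * 1 ^ 2) (s ^ 2) (2 * M) ≠ 0 := by
      refine qPochhammer_ne_zero fun i _ => sub_ne_zero.mpr fun h => hs (2 * i + 2) (by omega) ?_
      rw [h]; ring
    -- Modulo 6 the exponents `e₁`, `e₂` lie in `{0, 4}`, while `u` contributes 2; hence no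
    -- denominator vanishes.
    have ha' : ∀ i : ℕ, a * u * s ^ 5 * 1 ^ 3 * (s ^ 6) ^ i ≠ 1 := by
      intro i h
      have := eq_of_pow_mul_pow_eq_one hrs hs (i := e₁ + 6 * i) (l := 6 * m + (2 + 6 * (j + 1))) (by
        rw [← h, hu]
        linear_combination -(r ^ (2 + 6 * (j + 1)) * (s ^ 6) ^ i) * ha)
      omega
    have hb' : ∀ i : ℕ, b * u * s ^ 5 * 1 ^ 3 * (s ^ 6) ^ i ≠ 1 := by
      intro i h
      have := eq_of_pow_mul_pow_eq_one hrs hs (i := e₂ + 6 * m + 6 + 6 * i)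
        (l := 2 + 6 * (j + 1)) (by
        rw [← h, hu]
        linear_combination -(r ^ (2 + 6 * (j + 1)) * (s ^ 6) ^ i) * hb)
      omega
    have key := sum_cubicTerm_contiguous (u := u) hab (y := 1) (by simp) M hq
      (qPochhammer_ne_zero fun i _ => sub_ne_zero.mpr (ha' i).symm)
      (qPochhammer_ne_zero fun i _ => sub_ne_zero.mpr (hb' i).symm)
    have hH : cubicCertificate a b s 1 u M = 0 := by
      have : qPochhammer (a * s * 1) (s ^ 2) (M + 1) = 0 :=
        qPochhammer_eq_zero (i := M) (by omega) (by linear_combination hM)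
      rw [cubicCertificate, this]
      simp
    rw [hH] at key
    set T := ∑ k ∈ Finset.range (M + 1), cubicTerm a b s 1 u k
    set T' := ∑ k ∈ Finset.range (M + 1), cubicTerm a b s 1 (u * s ^ 6) k
    have hu2 : 1 - u * s ^ 2 ≠ 0 := by
      refine sub_ne_zero.mpr fun h => ?_
      have := eq_of_pow_mul_pow_eq_one hrs hs (i := 2) (l := 2 + 6 * (j + 1))
        (by rw [h, hu]; ring)
      omega
    have hn1 : 1 - u * s ^ e₁ ≠ 0 := by
      refine sub_ne_zero.mpr fun h => ?_
      have := eq_of_pow_mul_pow_eq_one hrs hs (i := e₁) (l := 2 + 6 * (j + 1))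
        (by rw [h, hu]; ring)
      omega
    have hn2 : 1 - u * s ^ (e₂ + 6 * m + 6) ≠ 0 := by
      refine sub_ne_zero.mpr fun h => ?_
      have := eq_of_pow_mul_pow_eq_one hrs hs (i := e₂ + 6 * m + 6) (l := 2 + 6 * (j + 1))
        (by rw [h, hu]; ring)
      omega
    have k1 : (1 - u) * (1 - u * s ^ 4) = (1 - u * s ^ e₁) * (1 - u * s ^ e₂) := by
      rcases he with ⟨rfl, rfl⟩ | ⟨rfl, rfl⟩ <;> ring
    have a1 : a * u * s ^ 5 = u * s ^ e₁ * r ^ (6 * m) := by linear_combination u * ha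
    have b1 : b * u * s ^ 5 = u * s ^ (e₂ + 6 * m + 6) := by linear_combination u * hb
    -- After cancelling `1 - u s²`, the relation is a first-order recurrence whose coefficients
    -- match the ratios of the two products, recorded in `hE` and `hF`.
    have key2 : T * (1 - u * s ^ e₁ * r ^ (6 * m)) * (1 - u * s ^ (e₂ + 6 * m + 6)) =
        (1 - u * s ^ e₁) * (1 - u * s ^ e₂) * T' := by
      refine mul_left_cancel₀ hu2 ?_
      rw [← k1, ← a1, ← b1]
      linear_combination key
    have hE : qPochhammer (u * s ^ 6 * s ^ e₁ * r ^ 6) (r ^ 6) m *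
        (1 - u * s ^ e₁ * r ^ (6 * m)) =
        (1 - u * s ^ e₁) * qPochhammer (u * s ^ e₁ * r ^ 6) (r ^ 6) m := by
      rw [show u * s ^ 6 * s ^ e₁ * r ^ 6 = u * s ^ e₁ * (r * s) ^ 6 by ring, hrs, one_pow,
        mul_one, pow_mul, ← qPochhammer_succ, qPochhammer_succ']
    have hF : qPochhammer (u * s ^ e₂) (s ^ 6) (m + 1) * (1 - u * s ^ (e₂ + 6 * m + 6)) =
        (1 - u * s ^ e₂) * qPochhammer (u * s ^ 6 * s ^ e₂) (s ^ 6) (m + 1) := by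
      rw [show u * s ^ 6 * s ^ e₂ = u * s ^ e₂ * s ^ 6 by ring, ← qPochhammer_succ',
        show u * s ^ (e₂ + 6 * m + 6) = u * s ^ e₂ * (s ^ 6) ^ (m + 1) by ring, ← qPochhammer_succ]
    refine mul_left_cancel₀ (mul_ne_zero hn1 hn2) ?_
    set E := qPochhammer (u * s ^ e₁ * r ^ 6) (r ^ 6) m
    set E' := qPochhammer (u * s ^ 6 * s ^ e₁ * r ^ 6) (r ^ 6) m
    set F := qPochhammer (u * s ^ e₂) (s ^ 6) (m + 1)
    set F' := qPochhammer (u * s ^ 6 * s ^ e₂) (s ^ 6) (m + 1)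
    set F0 := qPochhammer (r ^ 2 * s ^ e₂) (s ^ 6) (m + 1)
    set E0 := qPochhammer (r ^ 2 * s ^ e₁ * r ^ 6) (r ^ 6) m
    linear_combination (-T * (1 - u * s ^ (e₂ + 6 * m + 6)) * F0) * hE + E' * F0 * key2 +
      (1 - u * s ^ e₁) * (1 - u * s ^ e₂) * ih -
      (1 - u * s ^ e₁) * (1 - r ^ 2) * E0 * hF

open Polynomial in
-- Clearing the denominators makes the sum a polynomial in `u`, so that values at infinitely many
-- points determine it.
theorem exists_polynomial_sum_cubicTerm (a b s : K) (M : ℕ) :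
    ∃ P : K[X], ∀ u : K, qPochhammer (a * s ^ 5 * u) (s ^ 6) M ≠ 0 →
      qPochhammer (b * s ^ 5 * u) (s ^ 6) M ≠ 0 →
      (∑ k ∈ Finset.range (M + 1), cubicTerm a b s 1 u k) *
        (qPochhammer (a * s ^ 5 * u) (s ^ 6) M * qPochhammer (b * s ^ 5 * u) (s ^ 6) M) =
      P.eval u := by
  refine ⟨∑ k ∈ Finset.range (M + 1),
    C (qPochhammer (a * s) (s ^ 2) k * qPochhammer (b * s) (s ^ 2) k * s ^ (2 * k ^ 2) /
        qPochhammer (s ^ 2) (s ^ 2) (2 * k)) *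
      qPochhammer X (C (s ^ 2)) (2 * k) * (1 - X * C (s ^ (8 * k))) *
      (qPochhammer (C (a * s ^ 5) * X * C (s ^ 6) ^ k) (C (s ^ 6)) (M - k) *
        qPochhammer (C (b * s ^ 5) * X * C (s ^ 6) ^ k) (C (s ^ 6)) (M - k)), fun u ha hb => ?_⟩
  rw [Finset.sum_mul, eval_finsetSum]
  refine Finset.sum_congr rfl fun k hk => ?_
  have hkM : M = k + (M - k) := by have := Finset.mem_range.mp hk; omega
  have hmap : ∀ (x p : K[X]) (l : ℕ),
      (qPochhammer x p l).eval u = qPochhammer (x.eval u) (p.eval u) l :=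
    fun x p l => map_qPochhammer (evalRingHom u) x p l
  have sa : qPochhammer (a * s ^ 5 * u) (s ^ 6) M = _ :=
    (congrArg _ hkM).trans (qPochhammer_add _ _ k (M - k))
  have sb : qPochhammer (b * s ^ 5 * u) (s ^ 6) M = _ :=
    (congrArg _ hkM).trans (qPochhammer_add _ _ k (M - k))
  rw [sa] at ha ⊢
  rw [sb] at hb ⊢
  have ha0 := left_ne_zero_of_mul ha
  have hb0 := left_ne_zero_of_mul hb
  simp only [eval_mul, eval_sub, eval_one, eval_X, eval_C, eval_pow, hmap, cubicTerm, one_pow,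
    mul_one]
  rw [show a * u * s ^ 5 = a * s ^ 5 * u by ring, show b * u * s ^ 5 = b * s ^ 5 * u by ring]
  generalize qPochhammer (a * s ^ 5 * u) (s ^ 6) k = da at *
  generalize qPochhammer (b * s ^ 5 * u) (s ^ 6) k = db at *
  field_simp

/-- The terminating cubic series as a function of `u`. -/
theorem sum_cubicTerm_eq_qPochhammer {a b s r : K} (hab : a * b = 1) (hrs : r * s = 1)
    (hs : ∀ i, 0 < i → s ^ i ≠ 1) (M m e₁ e₂ : ℕ)
    (he : e₁ = 4 ∧ e₂ = 0 ∨ e₁ = 0 ∧ e₂ = 4)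
    (hM : a * s * s ^ (2 * M) = 1)
    (ha : a * s ^ 5 = s ^ e₁ * r ^ (6 * m)) (hb : b * s ^ 5 = s ^ (e₂ + 6 * m + 6))
    {u : K} (hau : qPochhammer (a * s ^ 5 * u) (s ^ 6) M ≠ 0)
    (hbu : qPochhammer (b * s ^ 5 * u) (s ^ 6) M ≠ 0) :
    (∑ k ∈ Finset.range (M + 1), cubicTerm a b s 1 u k) *
        qPochhammer (u * s ^ e₁ * r ^ 6) (r ^ 6) m *
        qPochhammer (r ^ 2 * s ^ e₂) (s ^ 6) (m + 1) =
      (1 - r ^ 2) * qPochhammer (r ^ 2 * s ^ e₁ * r ^ 6) (r ^ 6) m *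
        qPochhammer (u * s ^ e₂) (s ^ 6) (m + 1) := by
  obtain ⟨P, hP⟩ := exists_polynomial_sum_cubicTerm a b s M
  open Polynomial in
  have hpoly : P * qPochhammer (X * C (s ^ e₁ * r ^ 6)) (C (r ^ 6)) m *
        C (qPochhammer (r ^ 2 * s ^ e₂) (s ^ 6) (m + 1)) =
      C ((1 - r ^ 2) * qPochhammer (r ^ 2 * s ^ e₁ * r ^ 6) (r ^ 6) m) *
        qPochhammer (X * C (s ^ e₂)) (C (s ^ 6)) (m + 1) *
        (qPochhammer (C (a * s ^ 5) * X) (C (s ^ 6)) M *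
          qPochhammer (C (b * s ^ 5) * X) (C (s ^ 6)) M) := by
    refine Polynomial.eq_of_infinite_eval_eq _ _ ?_
    -- The points `r^(2 + 6j)` are distinct, so the two polynomials agree infinitely often.
    have hinj : Function.Injective fun j : ℕ => r ^ (2 + 6 * j) := by
      intro i j hij
      have := eq_of_pow_mul_pow_eq_one hrs hs (i := 2 + 6 * i) (l := 2 + 6 * j) (by
        rw [← show r ^ (2 + 6 * i) = r ^ (2 + 6 * j) from hij, ← mul_pow, mul_comm s, hrs, one_pow])
      omega
    refine (Set.infinite_range_of_injective hinj).mono ?_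
    rintro _ ⟨j, rfl⟩
    have hmap : ∀ (x p : K[X]) (l : ℕ), (qPochhammer x p l).eval (r ^ (2 + 6 * j)) =
        qPochhammer (x.eval (r ^ (2 + 6 * j))) (p.eval (r ^ (2 + 6 * j))) l :=
      fun x p l => map_qPochhammer (evalRingHom _) x p l
    have h := sum_cubicTerm_mul_qPochhammer hab hrs hs M m e₁ e₂ he hM ha hb j
    have hP' := hP (r ^ (2 + 6 * j))
      (qPochhammer_ne_zero fun i _ => sub_ne_zero.mpr fun h => by
        have := eq_of_pow_mul_pow_eq_one hrs hs (i := e₁ + 6 * i) (l := 6 * m + (2 + 6 * j))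
          (by rw [h, ha]; ring)
        omega)
      (qPochhammer_ne_zero fun i _ => sub_ne_zero.mpr fun h => by
        have := eq_of_pow_mul_pow_eq_one hrs hs (i := e₂ + 6 * m + 6 + 6 * i) (l := 2 + 6 * j)
          (by rw [h, hb]; ring)
        omega)
    simp only [Set.mem_ofPred_eq, eval_mul, hmap, eval_C, eval_X, ← hP', ← mul_assoc]
    linear_combination (qPochhammer (a * s ^ 5 * r ^ (2 + 6 * j)) (s ^ 6) M *
      qPochhammer (b * s ^ 5 * r ^ (2 + 6 * j)) (s ^ 6) M) * h
  have hmap : ∀ (x p : Polynomial K) (l : ℕ),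
      (qPochhammer x p l).eval u = qPochhammer (x.eval u) (p.eval u) l :=
    fun x p l => map_qPochhammer (Polynomial.evalRingHom u) x p l
  have h := congrArg (Polynomial.eval u) hpoly
  simp only [Polynomial.eval_mul, hmap, Polynomial.eval_C, Polynomial.eval_X, ← hP u hau hbu,
    ← mul_assoc] at h
  refine mul_right_cancel₀ (mul_ne_zero hau hbu) ?_
  linear_combination h

/-- Since `1 - r^i = -r^i (1 - s^i)`, each of the `m` pairs of factors contributes the same power
`r³`. -/
theorem prod_one_sub_pow_reflect {r s : K} (hrs : r * s = 1) (c m : ℕ) :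
    qPochhammer (r ^ (c + 1)) (r ^ 6) m * qPochhammer (s ^ (c + 4)) (s ^ 6) m * r ^ (3 * m) =
      qPochhammer (r ^ (c + 4)) (r ^ 6) m * qPochhammer (s ^ (c + 1)) (s ^ 6) m := by
  induction m with
  | zero => simp [qPochhammer_zero]
  | succ m ih =>
    simp only [qPochhammer_succ]
    have h : ∀ i : ℕ, r ^ i * s ^ i = 1 := fun i => by rw [← mul_pow, hrs, one_pow]
    have key : (1 - r ^ (c + 1) * (r ^ 6) ^ m) * (1 - s ^ (c + 4) * (s ^ 6) ^ m) * r ^ 3 =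
        (1 - r ^ (c + 4) * (r ^ 6) ^ m) * (1 - s ^ (c + 1) * (s ^ 6) ^ m) := by
      have h1 := h (c + 1 + 6 * m)
      have h2 := h 3
      linear_combination (1 - r ^ 3) * h1 +
        (r ^ (c + 1 + 6 * m) * s ^ (c + 1 + 6 * m) - s ^ (c + 1 + 6 * m)) * h2
    rw [show 3 * (m + 1) = 3 * m + 3 by ring, pow_add r (3 * m) 3]
    generalize qPochhammer (r ^ (c + 1)) (r ^ 6) m = x₁ at *
    generalize qPochhammer (s ^ (c + 4)) (s ^ 6) m = x₂ at *
    generalize qPochhammer (r ^ (c + 4)) (r ^ 6) m = x₃ at *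
    generalize qPochhammer (s ^ (c + 1)) (s ^ 6) m = x₄ at *
    linear_combination (1 - r ^ (c + 1) * (r ^ 6) ^ m) * (1 - s ^ (c + 4) * (s ^ 6) ^ m) *
      r ^ 3 * ih + x₃ * x₄ * key

end CubicSumEvaluation

/-! ### Evaluation of the deformed sum at `a = q^n`. -/

section DeformedSum

variable {K : Type*} [Field K]

theorem deformedSum_eq_sum_cubicTerm {a q : K} (hq : q ≠ 1) (n : ℕ) :
    deformedSum a q n = (∑ k ∈ Finset.range n, cubicTerm a a⁻¹ q 1 q k) / (1 - q) := by
  rw [deformedSum, Finset.sum_div]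
  refine Finset.sum_congr rfl fun k _ => ?_
  rw [qNumber_eq_div hq, cubicTerm]
  simp only [one_pow, mul_one]
  rw [show a * q * q ^ 5 = a * q ^ 6 by ring, show a⁻¹ * q * q ^ 5 = q ^ 6 / a by ring,
    show a⁻¹ * q = q / a by ring, show q * q ^ (8 * k) = q ^ (8 * k + 1) by ring]
  ring

theorem deformedSum_inv (a q : K) (n : ℕ) : deformedSum a⁻¹ q n = deformedSum a q n := by
  refine Finset.sum_congr rfl fun k _ => ?_
  rw [div_inv_eq_mul, div_inv_eq_mul, inv_mul_eq_div, inv_mul_eq_div, mul_comm q a,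
    mul_comm (q ^ 6) a]
  ring

theorem jacobiSym_neg_three_eq_one (m : ℕ) (hm : Odd (6 * m + 1)) : J(-3 | 6 * m + 1) = 1 := by
  rw [jacobiSym.mod_right _ hm, show 4 * Int.natAbs (-3) = 12 from rfl]
  have : (6 * m + 1) % 12 = 1 ∨ (6 * m + 1) % 12 = 7 := by omega
  rcases this with h | h <;> rw [h] <;> norm_num

theorem jacobiSym_neg_three_eq_neg_one (m : ℕ) (hm : Odd (6 * m + 5)) :
    J(-3 | 6 * m + 5) = -1 := by
  rw [jacobiSym.mod_right _ hm, show 4 * Int.natAbs (-3) = 12 from rfl]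
  have : (6 * m + 5) % 12 = 5 ∨ (6 * m + 5) % 12 = 11 := by omega
  rcases this with h | h <;> rw [h] <;> norm_num

/-- The product formula at `u = s`. Reflection supplies `r^(3m)`; for `n = 6m + 5` the extra
quotient `(1 - r²)/(1 - s²) = -r²` supplies both the sign and the missing power of `r`. -/
theorem sum_cubicTerm_inv_pow {s r : K} (hrs : r * s = 1) (hs : ∀ i, 0 < i → s ^ i ≠ 1)
    {n M : ℕ} (hn6 : Nat.Coprime n 6) (hM : n = 2 * M + 1) :
    ∑ k ∈ Finset.range n, cubicTerm (r ^ n) (s ^ n) s 1 s k =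
      r ^ M * (1 - s ^ n) * ((J(-3 | n) : ℤ) : K) := by
  have hpow : ∀ i, r ^ i * s ^ i = 1 := fun i => by rw [← mul_pow, hrs, one_pow]
  have hr : ∀ i, 0 < i → r ^ i ≠ 1 := fun i hi h => hs i hi (by simpa [h] using hpow i)
  have hsM : r ^ n * s * s ^ (2 * M) = 1 := by
    rw [mul_assoc, ← pow_succ', ← hM, hpow]
  -- The factor `1 - a s^(2M+1)` vanishes, so all terms beyond `k = M` are zero.
  have hcut : ∑ k ∈ Finset.range n, cubicTerm (r ^ n) (s ^ n) s 1 s k =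
      ∑ k ∈ Finset.range (M + 1), cubicTerm (r ^ n) (s ^ n) s 1 s k := by
    refine (Finset.sum_subset (Finset.range_mono (by omega)) fun k _ hk => ?_).symm
    have : qPochhammer (r ^ n * s * 1) (s ^ 2) k = 0 :=
      qPochhammer_eq_zero (i := M) (by simpa using hk) (by linear_combination hsM)
    rw [cubicTerm, this]
    simp
  rw [hcut]
  clear hcut
  have hodd : Odd n := ⟨M, hM⟩
  have hn3 : n % 3 ≠ 0 := fun h => by
    have : 3 ∣ Nat.gcd n 6 := Nat.dvd_gcd (Nat.dvd_of_mod_eq_zero h) (by norm_num)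
    rw [hn6] at this
    omega
  have hau : qPochhammer (r ^ n * s ^ 5 * s) (s ^ 6) M ≠ 0 :=
    qPochhammer_ne_zero fun i _ => sub_ne_zero.mpr fun h => by
      have := eq_of_pow_mul_pow_eq_one hrs hs (i := 6 * i + 6) (l := n) (by rw [h]; ring)
      omega
  have hbu : qPochhammer (s ^ n * s ^ 5 * s) (s ^ 6) M ≠ 0 :=
    qPochhammer_ne_zero fun i _ => sub_ne_zero.mpr fun h => by
      refine hs (n + 6 * i + 6) (by omega) ?_
      rw [h]; ring
  have hr2 : 1 - r ^ 2 ≠ 0 := sub_ne_zero.mpr (hr 2 (by omega)).symm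
  have hs2 : 1 - s ^ 2 ≠ 0 := sub_ne_zero.mpr (hs 2 (by omega)).symm
  have hrP : ∀ c m, 0 < c → qPochhammer (r ^ c) (r ^ 6) m ≠ 0 := fun c m hc =>
    qPochhammer_ne_zero fun i _ => sub_ne_zero.mpr fun h =>
      hr (c + 6 * i) (by omega) (by rw [h]; ring)
  have hsP : ∀ c m, 0 < c → qPochhammer (s ^ c) (s ^ 6) m ≠ 0 := fun c m hc =>
    qPochhammer_ne_zero fun i _ => sub_ne_zero.mpr fun h =>
      hs (c + 6 * i) (by omega) (by rw [h]; ring)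
  -- The two classes correspond to `(e₁, e₂) = (4, 0)` and `(0, 4)`, read off from `a s⁵ = s^(5-n)`
  -- and `b s⁵ = s^(n+5)`.
  obtain ⟨m, hm | hm⟩ : ∃ m, n = 6 * m + 1 ∨ n = 6 * m + 5 := ⟨n / 6, by omega⟩
  · have hsum := sum_cubicTerm_eq_qPochhammer (a := r ^ n) (b := s ^ n) (hpow n) hrs hs M m 4 0
      (Or.inl ⟨rfl, rfl⟩) hsM
      (by rw [hm]; linear_combination r ^ (6 * m) * s ^ 4 * hrs) (by rw [hm]; ring) hau hbu
    have href := prod_one_sub_pow_reflect hrs 0 m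
    have hj : J(-3 | n) = 1 := by
      rw [hm] at hodd ⊢
      exact jacobiSym_neg_three_eq_one m hodd
    rw [hj, show M = 3 * m by omega] at *
    rw [show s * s ^ 4 * r ^ 6 = r ^ (0 + 1) by linear_combination r * hpow 5,
      show r ^ 2 * s ^ 4 * r ^ 6 = r ^ (0 + 4) by linear_combination r ^ 4 * hpow 4,
      qPochhammer_succ', qPochhammer_succ,
      show r ^ 2 * s ^ 0 * s ^ 6 = s ^ (0 + 4) by linear_combination s ^ 4 * hpow 2,
      show s * s ^ 0 = s ^ (0 + 1) by ring] at hsum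
    have hsn : s ^ n = s ^ (0 + 1) * (s ^ 6) ^ m := by rw [hm]; ring
    generalize ∑ k ∈ Finset.range _, cubicTerm (r ^ n) (s ^ n) s 1 s k = T at *
    rw [hsn]
    have h1 := hrP (0 + 1) m (by omega)
    have h2 := hsP (0 + 4) m (by omega)
    refine mul_right_cancel₀ (mul_ne_zero (mul_ne_zero h1 h2) hr2) ?_
    push_cast
    linear_combination hsum - (1 - r ^ 2) * (1 - s ^ (0 + 1) * (s ^ 6) ^ m) * href
  · have hsum := sum_cubicTerm_eq_qPochhammer (a := r ^ n) (b := s ^ n) (hpow n) hrs hs M m 0 4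
      (Or.inr ⟨rfl, rfl⟩) hsM
      (by rw [hm]; linear_combination r ^ (6 * m) * hpow 5) (by rw [hm]; ring) hau hbu
    have href := prod_one_sub_pow_reflect hrs 4 m
    have hj : J(-3 | n) = -1 := by
      rw [hm] at hodd ⊢
      exact jacobiSym_neg_three_eq_neg_one m hodd
    rw [hj, show M = 3 * m + 2 by omega] at *
    rw [show s * s ^ 0 * r ^ 6 = r ^ (4 + 1) by linear_combination r ^ 5 * hrs,
      show r ^ 2 * s ^ 0 * r ^ 6 = r ^ (4 + 4) by ring,
      qPochhammer_succ', qPochhammer_succ,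
      show r ^ 2 * s ^ 4 = s ^ 2 by linear_combination s ^ 2 * hpow 2,
      show s ^ 2 * s ^ 6 = s ^ (4 + 4) by ring,
      show s * s ^ 4 = s ^ (4 + 1) by ring] at hsum
    have hsn : s ^ n = s ^ (4 + 1) * (s ^ 6) ^ m := by rw [hm]; ring
    generalize ∑ k ∈ Finset.range _, cubicTerm (r ^ n) (s ^ n) s 1 s k = T at *
    rw [hsn]
    have h1 := hrP (4 + 1) m (by omega)
    have h2 := hsP (4 + 4) m (by omega)
    refine mul_right_cancel₀ (mul_ne_zero (mul_ne_zero h1 h2) hs2) ?_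
    push_cast
    rw [pow_add r (3 * m) 2]
    generalize qPochhammer (r ^ (4 + 1)) (r ^ 6) m = x₁ at *
    generalize qPochhammer (s ^ (4 + 4)) (s ^ 6) m = x₂ at *
    generalize qPochhammer (r ^ (4 + 4)) (r ^ 6) m = x₃ at *
    generalize qPochhammer (s ^ (4 + 1)) (s ^ 6) m = x₄ at *
    have h3 := hpow 2
    linear_combination hsum - (1 - r ^ 2) * (1 - s ^ (4 + 1) * (s ^ 6) ^ m) * href -
      x₁ * x₂ * r ^ (3 * m) * (1 - s ^ (4 + 1) * (s ^ 6) ^ m) * h3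

theorem deformedSum_pow {s : K} (hs0 : s ≠ 0) (hs : ∀ i, 0 < i → s ^ i ≠ 1) {n : ℕ}
    (hn6 : Nat.Coprime n 6) :
    deformedSum (s ^ n) s n =
      s ^ (-(((n : ℤ) - 1) / 2)) * qNumber s n * ((J(-3 | n) : ℤ) : K) := by
  have hodd : Odd n := by
    rw [← Nat.not_even_iff_odd]
    intro h
    have : 2 ∣ Nat.gcd n 6 := Nat.dvd_gcd h.two_dvd (by norm_num)
    rw [hn6] at this
    omega
  obtain ⟨M, hM⟩ := hodd
  have hs1 : s ≠ 1 := by simpa using hs 1 one_pos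
  have h := sum_cubicTerm_inv_pow (inv_mul_cancel₀ hs0) hs hn6 hM
  rw [← deformedSum_inv, deformedSum_eq_sum_cubicTerm hs1, inv_inv, ← inv_pow, h,
    qNumber_eq_div hs1, show (((n : ℤ) - 1) / 2) = (M : ℤ) by omega, zpow_neg, zpow_natCast,
    inv_pow]
  ring

end DeformedSum

/-! ### Vanishing of the deformed sum at roots of unity. -/

section RootOfUnity

variable {K : Type*} [Field K]

/-- The summand of the deformed sum, up to the factor `1 - q`, with the quotient
`(q; q²)_m / (q²; q²)_m` replaced by `g m`. -/
def deformedTerm (g : ℕ → K) (a b q : K) (k : ℕ) : K :=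
  qPochhammer (a * q) (q ^ 2) k * qPochhammer (b * q) (q ^ 2) k * g (2 * k) *
      (1 - q ^ (8 * k + 1)) * q ^ (2 * k ^ 2) /
    (qPochhammer (a * q ^ 6) (q ^ 6) k * qPochhammer (b * q ^ 6) (q ^ 6) k)

theorem central_ratio_add {g : ℕ → K} {q : K}
    (hg : ∀ m, g (m + 1) * (1 - q ^ (2 * m + 2)) = g m * (1 - q ^ (2 * m + 1))) (m i : ℕ) :
    g (m + i) * qPochhammer (q ^ 2 * (q ^ m) ^ 2) (q ^ 2) i =
      g m * qPochhammer (q * (q ^ m) ^ 2) (q ^ 2) i := by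
  induction i with
  | zero => simp [qPochhammer_zero]
  | succ i ih =>
    rw [qPochhammer_succ, qPochhammer_succ, ← add_assoc]
    have h := hg (m + i)
    generalize qPochhammer (q ^ 2 * (q ^ m) ^ 2) (q ^ 2) i = x₁ at *
    generalize qPochhammer (q * (q ^ m) ^ 2) (q ^ 2) i = x₂ at *
    linear_combination x₁ * h + (1 - q ^ (2 * (m + i) + 1)) * ih

/-- Starting from index `k` gives, up to a constant factor, a cubic series with `y = q^(2k)`; this
is why `cubicTerm` carries `y`. -/
theorem deformedTerm_add {g : ℕ → K} {a b q : K}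
    (hg : ∀ m, g (m + 1) * (1 - q ^ (2 * m + 2)) = g m * (1 - q ^ (2 * m + 1))) (k j : ℕ)
    (hq : qPochhammer (q ^ 2 * (q ^ (2 * k)) ^ 2) (q ^ 2) (2 * j) ≠ 0) :
    deformedTerm g a b q (k + j) =
      (qPochhammer (a * q) (q ^ 2) k * qPochhammer (b * q) (q ^ 2) k * g (2 * k) *
        q ^ (2 * k ^ 2) / (qPochhammer (a * q ^ 6) (q ^ 6) k * qPochhammer (b * q ^ 6) (q ^ 6) k)) *
      cubicTerm a b q (q ^ (2 * k)) q j := by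
  have h : g (2 * (k + j)) = g (2 * k) * qPochhammer (q * (q ^ (2 * k)) ^ 2) (q ^ 2) (2 * j) /
      qPochhammer (q ^ 2 * (q ^ (2 * k)) ^ 2) (q ^ 2) (2 * j) := by
    rw [eq_div_iff hq, mul_add, central_ratio_add hg]
  rw [deformedTerm, cubicTerm, h]
  simp only [qPochhammer_add _ _ k j]
  rw [show a * q * (q ^ 2) ^ k = a * q * q ^ (2 * k) by ring,
    show b * q * (q ^ 2) ^ k = b * q * q ^ (2 * k) by ring,
    show a * q * q ^ 5 * (q ^ (2 * k)) ^ 3 = a * q ^ 6 * (q ^ 6) ^ k by ring,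
    show b * q * q ^ 5 * (q ^ (2 * k)) ^ 3 = b * q ^ 6 * (q ^ 6) ^ k by ring,
    show q * (q ^ (2 * k)) ^ 4 * q ^ (8 * j) = q ^ (8 * (k + j) + 1) by ring,
    show q ^ (2 * (k + j) ^ 2) = q ^ (2 * k ^ 2) * (q ^ (2 * j ^ 2) * (q ^ (2 * k)) ^ (2 * j)) by
      ring]
  simp only [div_eq_mul_inv, mul_inv]
  ring

/-- The function `g` is constrained only by a division-free recurrence, since `(ζ²; ζ²)_m` vanishes
for `m ≥ d`. Each block of `d = 2N + 1` terms is cut where this zero enters, and each half is a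
vanishing cubic sum. -/
theorem sum_deformedTerm_eq_zero {ζ a b : K} (hab : a * b = 1) {d : ℕ} (hζ : IsPrimitiveRoot ζ d)
    (hd : 1 < d) (hd6 : Nat.Coprime d 6) (ha : ∀ z : K, z ^ d = 1 → a * z ≠ 1)
    (hb : ∀ z : K, z ^ d = 1 → b * z ≠ 1) {g : ℕ → K}
    (hg : ∀ m, g (m + 1) * (1 - ζ ^ (2 * m + 2)) = g m * (1 - ζ ^ (2 * m + 1))) (e : ℕ) :
    ∑ k ∈ Finset.range (d * e), deformedTerm g a b ζ k = 0 := by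
  have hd2 : d % 2 ≠ 0 := fun h => by
    have : 2 ∣ Nat.gcd d 6 := Nat.dvd_gcd (Nat.dvd_of_mod_eq_zero h) (by norm_num)
    rw [hd6] at this
    omega
  have hd3 : d % 3 ≠ 0 := fun h => by
    have : 3 ∣ Nat.gcd d 6 := Nat.dvd_gcd (Nat.dvd_of_mod_eq_zero h) (by norm_num)
    rw [hd6] at this
    omega
  obtain ⟨N, hN⟩ : ∃ N, d = 2 * N + 1 := ⟨d / 2, by omega⟩
  have hζd : ζ ^ d = 1 := hζ.pow_eq_one
  have hζ2 : ∀ i, 0 < i → i < d → ζ ^ (2 * i) ≠ 1 := fun i hi hid h => by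
    have h1 := (hζ.pow_eq_one_iff_dvd _).mp h
    have h2 : Nat.Coprime d 2 := Nat.Coprime.coprime_dvd_right (by norm_num) hd6
    have := Nat.le_of_dvd hi (h2.dvd_of_dvd_mul_left h1)
    omega
  have block : ∀ k M : ℕ, (ζ ^ (2 * k)) ^ 2 = 1 ∨ (ζ ^ (2 * k)) ^ 2 = ζ ^ 2 → N ≤ 2 * M + 1 →
      qPochhammer (ζ ^ 2 * (ζ ^ (2 * k)) ^ 2) (ζ ^ 2) (2 * M) ≠ 0 →
      ∑ j ∈ Finset.range (M + 1), deformedTerm g a b ζ (k + j) = 0 := by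
    intro k M hy hM hq
    -- Apart from `a` or `b`, the whole product is a `d`-th root of unity, so `ha` and `hb` exclude
    -- the value 1.
    have hu : ∀ (N' : ℕ) (u : K), u * ζ ^ (2 * N') = 1 → ∀ i : ℕ,
        (u * ζ ^ 5 * (ζ ^ (2 * k)) ^ 3 * (ζ ^ 6) ^ i) ^ d = 1 := by
      intro N' u h i
      have hud : u ^ d = 1 := by
        have := congrArg (· ^ d) h
        simpa [mul_pow, ← pow_mul, mul_comm _ d, pow_mul ζ d, hζd] using this
      simp [mul_pow, ← pow_mul, mul_comm _ d, pow_mul ζ d, hζd, hud]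
    have h := sum_cubicTerm_eq_zero hab hy M hq
      (fun N' u h i => by
        simpa only [mul_assoc] using ha _ (hu N' u h i))
      (fun N' u h i => by
        simpa only [mul_assoc] using hb _ (hu N' u h i))
      N (by omega) hM (by omega) (fun j hj hj' => hζ2 j (by omega) (by omega)) ζ
      (by rw [← pow_succ', ← hN, hζd])
    rw [Finset.sum_congr rfl fun j hj => deformedTerm_add hg k j ?_, ← Finset.mul_sum, h, mul_zero]
    have hj' : j ≤ M := Nat.lt_succ_iff.mp (Finset.mem_range.mp hj)
    rw [show 2 * M = 2 * j + 2 * (M - j) by omega, qPochhammer_add] at hq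
    exact left_ne_zero_of_mul hq
  induction e with
  | zero => simp
  | succ e ih =>
    have h0 : ζ ^ (2 * (d * e)) = 1 := by
      rw [show 2 * (d * e) = d * (2 * e) by ring, pow_mul, hζd, one_pow]
    have h1 : ζ ^ (2 * (d * e + (N + 1))) = ζ := by
      rw [mul_add, pow_add, h0, show 2 * (N + 1) = d + 1 by omega, pow_succ, hζd]
      ring
    rw [mul_add, mul_one, Finset.sum_range_add, ih, zero_add]
    -- The first half starts at `y = 1`, the second at `y = ζ`, the two starting points free of a
    -- boundary term.
    nth_rw 1 [show d = (N + 1) + ((N - 1) + 1) by omega]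
    rw [Finset.sum_range_add, block _ N (by rw [h0]; simp) (by omega), zero_add]
    · simp only [← add_assoc] at *
      refine block _ (N - 1) (by rw [h1]; simp) (by omega) ?_
      rw [h1]
      refine qPochhammer_ne_zero fun i hi => sub_ne_zero.mpr fun h => ?_
      exact hζ2 (i + 2) (by omega) (by omega) (by rw [h]; ring)
    · rw [h0]
      refine qPochhammer_ne_zero fun i hi => sub_ne_zero.mpr fun h => ?_
      exact hζ2 (i + 1) (by omega) (by omega) (by rw [h]; ring)

end RootOfUnity

/-! ### Congruences of fractions through homomorphisms to fields. -/

section PrimeKernel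

variable {R : Type*} [CommRing R] {L : Type*} [Field L]

theorem prime_of_map_eq_zero_iff {φ : R →+* L} {P : R} (hP : P ≠ 0)
    (hφ : ∀ x, φ x = 0 ↔ P ∣ x) : Prime P := by
  refine ⟨hP, fun h => ?_, fun x y h => ?_⟩
  · have := (hφ 1).mpr h.dvd
    simp at this
  · rw [← hφ, map_mul, mul_eq_zero] at h
    rwa [← hφ, ← hφ]

theorem algebraMap_ne_zero_of_map_ne_zero {φ : R →+* L} {y : R} (hy : φ y ≠ 0) : algebraMap R (FractionRing R) y ≠ 0 := by
  intro h
  rw [map_eq_zero_iff _ (IsFractionRing.injective R (FractionRing R))] at h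
  exact hy (by rw [h, map_zero])

variable [IsDomain R]

theorem isRelPrime_of_map_ne_zero {φ : R →+* L} {P : R} (hP : P ≠ 0)
    (hφ : ∀ x, φ x = 0 ↔ P ∣ x) {y : R} (hy : φ y ≠ 0) : IsRelPrime P y :=
  (prime_of_map_eq_zero_iff hP hφ).irreducible.isRelPrime_iff_not_dvd.mpr
    fun h => hy ((hφ y).mpr h)

/-- The fraction `A` has a representation whose denominator is not killed by `φ`, and `φ` maps it
to `v`. -/
def EvalsTo (φ : R →+* L) (A : FractionRing R) (v : L) : Prop :=
  ∃ x y : R, φ y ≠ 0 ∧ A = algebraMap R (FractionRing R) x / algebraMap R (FractionRing R) y ∧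
    φ x = v * φ y

namespace EvalsTo

variable {φ : R →+* L} {A B : FractionRing R} {v w : L}

theorem of_algebraMap (φ : R →+* L) (x : R) :
    EvalsTo φ (algebraMap R (FractionRing R) x) (φ x) :=
  ⟨x, 1, by simp, by simp, by simp⟩

theorem one (φ : R →+* L) : EvalsTo φ 1 1 := by
  simpa using of_algebraMap φ 1

theorem zero (φ : R →+* L) : EvalsTo φ 0 0 := by
  simpa using of_algebraMap φ 0

theorem intCast (φ : R →+* L) (z : ℤ) : EvalsTo φ (z : FractionRing R) (z : L) := by
  simpa using of_algebraMap φ (z : R)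

theorem add (hA : EvalsTo φ A v) (hB : EvalsTo φ B w) : EvalsTo φ (A + B) (v + w) := by
  obtain ⟨x, y, hy, rfl, h⟩ := hA
  obtain ⟨x', y', hy', rfl, h'⟩ := hB
  refine ⟨x * y' + y * x', y * y', by simp [hy, hy'], ?_, ?_⟩
  · rw [div_add_div _ _ (algebraMap_ne_zero_of_map_ne_zero hy) (algebraMap_ne_zero_of_map_ne_zero hy')]
    simp
  · simp only [map_add, map_mul, h, h']
    ring

theorem mul (hA : EvalsTo φ A v) (hB : EvalsTo φ B w) : EvalsTo φ (A * B) (v * w) := by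
  obtain ⟨x, y, hy, rfl, h⟩ := hA
  obtain ⟨x', y', hy', rfl, h'⟩ := hB
  refine ⟨x * x', y * y', by simp [hy, hy'], ?_, ?_⟩
  · rw [div_mul_div_comm]
    simp
  · simp only [map_mul, h, h']
    ring

theorem sub (hA : EvalsTo φ A v) (hB : EvalsTo φ B w) : EvalsTo φ (A - B) (v - w) := by
  have h : EvalsTo φ (-1) (-1) := by simpa using of_algebraMap φ (-1)
  convert hA.add (h.mul hB) using 1 <;> ring

theorem inv (hA : EvalsTo φ A v) (hv : v ≠ 0) : EvalsTo φ A⁻¹ v⁻¹ := by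
  obtain ⟨x, y, hy, rfl, h⟩ := hA
  refine ⟨y, x, by rw [h]; exact mul_ne_zero hv hy, by rw [inv_div], ?_⟩
  rw [h, inv_mul_cancel_left₀ hv]

theorem div (hA : EvalsTo φ A v) (hB : EvalsTo φ B w) (hw : w ≠ 0) :
    EvalsTo φ (A / B) (v / w) := by
  rw [div_eq_mul_inv, div_eq_mul_inv]
  exact hA.mul (hB.inv hw)

theorem pow (hA : EvalsTo φ A v) (n : ℕ) : EvalsTo φ (A ^ n) (v ^ n) := by
  induction n with
  | zero => simpa using one φ
  | succ n ih =>
    rw [pow_succ, pow_succ]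
    exact ih.mul hA

theorem zpow (hA : EvalsTo φ A v) (hv : v ≠ 0) (n : ℤ) : EvalsTo φ (A ^ n) (v ^ n) := by
  rcases n with n | n
  · simpa using hA.pow n
  · rw [zpow_negSucc, zpow_negSucc]
    exact (hA.pow _).inv (pow_ne_zero _ hv)

theorem sum {ι : Type*} (s : Finset ι) {f : ι → FractionRing R} {g : ι → L}
    (h : ∀ i ∈ s, EvalsTo φ (f i) (g i)) : EvalsTo φ (∑ i ∈ s, f i) (∑ i ∈ s, g i) := by
  classical
  induction s using Finset.induction_on with
  | empty => simpa using zero φ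
  | insert i s hi ih =>
    rw [Finset.sum_insert hi, Finset.sum_insert hi]
    exact (h i (by simp)).add (ih fun j hj => h j (by simp [hj]))

theorem prod {ι : Type*} (s : Finset ι) {f : ι → FractionRing R} {g : ι → L}
    (h : ∀ i ∈ s, EvalsTo φ (f i) (g i)) : EvalsTo φ (∏ i ∈ s, f i) (∏ i ∈ s, g i) := by
  classical
  induction s using Finset.induction_on with
  | empty => simpa using one φ
  | insert i s hi ih =>
    rw [Finset.prod_insert hi, Finset.prod_insert hi]
    exact (h i (by simp)).mul (ih fun j hj => h j (by simp [hj]))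

theorem qPochhammer (hA : EvalsTo φ A v) (hB : EvalsTo φ B w) (k : ℕ) :
    EvalsTo φ (qPochhammer A B k) (qPochhammer v w k) :=
  prod _ fun j _ => (one φ).sub (hA.mul (hB.pow j))

theorem qNumber (hA : EvalsTo φ A v) (k : ℕ) : EvalsTo φ (qNumber A k) (qNumber v k) :=
  sum _ fun j _ => hA.pow j

/-- A common value puts the numerator of the difference in the kernel, which is generated by the
prime `P`, and keeps the denominator outside it. -/
theorem fracModEq {P : R} (hP : P ≠ 0) (hφ : ∀ x, φ x = 0 ↔ P ∣ x) (hA : EvalsTo φ A v)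
    (hB : EvalsTo φ B v) : FracModEq P A B := by
  obtain ⟨x, y, hy, h, hx⟩ := hA.sub hB
  refine ⟨x, y, ?_, h, ?_, isRelPrime_of_map_ne_zero hP hφ hy⟩
  · rintro rfl
    exact hy (map_zero φ)
  · rw [← hφ, hx, sub_self, zero_mul]

end EvalsTo

/-- Any witnessing fraction transfers to lowest terms, so one representation serves all moduli at
once and coprime moduli can be multiplied. -/
theorem FracModEq.of_reduced [UniqueFactorizationMonoid R] {P : R} {A B : FractionRing R}
    (h : FracModEq P A B) {x y : R} (hy : y ≠ 0) (hxy : IsRelPrime x y)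
    (he : A - B = algebraMap R (FractionRing R) x / algebraMap R (FractionRing R) y) :
    P ∣ x ∧ IsRelPrime P y := by
  obtain ⟨x', y', hy', h, hP, hrel⟩ := h
  have hinj := IsFractionRing.injective R (FractionRing R)
  have e : x * y' = x' * y := by
    apply hinj
    rw [he, div_eq_div_iff ((map_ne_zero_iff _ hinj).mpr hy) ((map_ne_zero_iff _ hinj).mpr hy')]
      at h
    simpa using h
  refine ⟨hrel.dvd_of_dvd_mul_right (e ▸ hP.mul_right y), ?_⟩
  have hd : y ∣ y' := hxy.symm.dvd_of_dvd_mul_left (e ▸ dvd_mul_left y x')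
  exact fun z hz hz' => hrel hz (hz'.trans hd)

theorem exists_reduced_sub [UniqueFactorizationMonoid R] (A B : FractionRing R) :
    ∃ x y : R, y ≠ 0 ∧ IsRelPrime x y ∧
      A - B = algebraMap R (FractionRing R) x / algebraMap R (FractionRing R) y := by
  obtain ⟨x, y, h, e⟩ := IsFractionRing.exists_reduced_fraction R (A - B)
  exact ⟨x, y, nonZeroDivisors.coe_ne_zero y, h, by rw [← e, IsFractionRing.mk'_eq_div]⟩

theorem FracModEq.mul [UniqueFactorizationMonoid R] {P Q : R} {A B : FractionRing R}
    (hP : FracModEq P A B) (hQ : FracModEq Q A B) (hPQ : IsRelPrime P Q) :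
    FracModEq (P * Q) A B := by
  obtain ⟨x, y, hy, hxy, he⟩ := exists_reduced_sub A B
  obtain ⟨h1, h2⟩ := hP.of_reduced hy hxy he
  obtain ⟨h3, h4⟩ := hQ.of_reduced hy hxy he
  exact ⟨x, y, hy, he, hPQ.mul_dvd h1 h3, h2.mul_left h4⟩

theorem FracModEq.prod [UniqueFactorizationMonoid R] {ι : Type*} {s : Finset ι} {P : ι → R}
    {A B : FractionRing R} (h : ∀ i ∈ s, FracModEq (P i) A B)
    (hP : (s : Set ι).Pairwise (Function.onFun IsRelPrime P)) :
    FracModEq (∏ i ∈ s, P i) A B := by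
  obtain ⟨x, y, hy, hxy, he⟩ := exists_reduced_sub A B
  exact ⟨x, y, hy, he, Finset.prod_dvd_of_isRelPrime hP fun i hi =>
    ((h i hi).of_reduced hy hxy he).1, IsRelPrime.prod_left fun i hi =>
    ((h i hi).of_reduced hy hxy he).2⟩

end PrimeKernel

/-! ### Integrality of the central `q`-binomial coefficient. -/

section CentralRatio

variable {R : Type*} [CommRing R]

/-- Induction by the `q`-Pascal rule, which provides the Gaussian binomial without division. -/
theorem exists_qBinomial (q : R) (k l : ℕ) :
    ∃ B : R, B * (qPochhammer q q k * qPochhammer q q l) = qPochhammer q q (k + l) := by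
  induction k generalizing l with
  | zero => exact ⟨1, by simp [qPochhammer_zero]⟩
  | succ k ihk =>
    induction l with
    | zero => exact ⟨1, by simp [qPochhammer_zero]⟩
    | succ l ihl =>
      obtain ⟨B₁, h₁⟩ := ihk (l + 1)
      obtain ⟨B₂, h₂⟩ := ihl
      refine ⟨B₁ + q ^ (k + 1) * B₂, ?_⟩
      have e : qPochhammer q q (k + 1 + (l + 1)) =
          qPochhammer q q (k + 1 + l) * (1 - q ^ (k + l + 2)) := by
        rw [← add_assoc, qPochhammer_succ]
        ring
      rw [show k + (l + 1) = k + 1 + l by ring] at h₁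
      have ek : qPochhammer q q (k + 1) = qPochhammer q q k * (1 - q ^ (k + 1)) := by
        rw [qPochhammer_succ, pow_succ']
      have el : qPochhammer q q (l + 1) = qPochhammer q q l * (1 - q ^ (l + 1)) := by
        rw [qPochhammer_succ, pow_succ']
      rw [e]
      rw [el] at h₁ ⊢
      rw [ek] at h₂ ⊢
      generalize qPochhammer q q k = x at *
      generalize qPochhammer q q l = z at *
      generalize qPochhammer q q (k + 1 + l) = w at *
      linear_combination (1 - q ^ (k + 1)) * h₁ + q ^ (k + 1) * (1 - q ^ (l + 1)) * h₂

theorem qPochhammer_two_mul (q : R) (m : ℕ) :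
    qPochhammer q q (2 * m) = qPochhammer q (q ^ 2) m * qPochhammer (q ^ 2) (q ^ 2) m := by
  induction m with
  | zero => simp [qPochhammer_zero]
  | succ m ih =>
    rw [show 2 * (m + 1) = 2 * m + 1 + 1 by ring]
    simp only [qPochhammer_succ, ih]
    ring

theorem qPochhammer_sq (q : R) (m : ℕ) :
    qPochhammer (q ^ 2) (q ^ 2) m = qPochhammer q q m * qPochhammer (-q) q m := by
  induction m with
  | zero => simp [qPochhammer_zero]
  | succ m ih =>
    simp only [qPochhammer_succ, ih]
    ring

/-- The fraction `(q; q²)_m / (q²; q²)_m` has the denominator `(-q; q)_m²`. -/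
theorem exists_central_ratio [IsDomain R] {q : R} (hq : ∀ i, 0 < i → q ^ i ≠ 1) (m : ℕ) :
    ∃ B : R, B * qPochhammer (q ^ 2) (q ^ 2) m =
      qPochhammer q (q ^ 2) m * qPochhammer (-q) q m ^ 2 := by
  obtain ⟨B, h⟩ := exists_qBinomial q m m
  refine ⟨B, ?_⟩
  have h0 : qPochhammer (q ^ 2) (q ^ 2) m ≠ 0 :=
    qPochhammer_ne_zero fun i _ => sub_ne_zero.mpr fun h =>
      hq (2 * i + 2) (by omega) (by rw [h]; ring)
  refine mul_right_cancel₀ h0 ?_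
  rw [← two_mul, qPochhammer_two_mul] at h
  have h1 := qPochhammer_sq q m
  generalize qPochhammer (q ^ 2) (q ^ 2) m = x at *
  generalize qPochhammer (-q) q m = z at *
  generalize qPochhammer q q m = w at *
  linear_combination z ^ 2 * h + B * (x + w * z) * h1

end CentralRatio

/-! ### Congruences modulo a single prime factor. -/

section Congruences

open Polynomial TwoIndeterminates

theorem deformedSum_eq_sum_deformedTerm {K : Type*} [Field K] {a q : K} (hq : q ≠ 1) (n : ℕ) :
    deformedSum a q n = (∑ k ∈ Finset.range n, deformedTerm
      (fun m => qPochhammer q (q ^ 2) m / qPochhammer (q ^ 2) (q ^ 2) m) a a⁻¹ q k) / (1 - q) := by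
  rw [deformedSum, Finset.sum_div]
  refine Finset.sum_congr rfl fun k _ => ?_
  rw [qNumber_eq_div hq, deformedTerm, show a⁻¹ * q = q / a by ring,
    show a⁻¹ * q ^ 6 = q ^ 6 / a by ring]
  simp only [div_eq_mul_inv, mul_inv]
  ring

theorem algebraMap_injective_rationalFunctions :
    Function.Injective (algebraMap ℤ[X][Y] RationalFunctions) :=
  IsFractionRing.injective _ _

theorem q_pow_ne_one (i : ℕ) (hi : 0 < i) : q ^ i ≠ 1 := by
  intro h
  rw [q, ← C_pow, ← C_1] at h
  have := congrArg natDegree (C_injective h)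
  rw [natDegree_X_pow, natDegree_one] at this
  omega

theorem q'_pow_ne_one (i : ℕ) (hi : 0 < i) : q' ^ i ≠ 1 := by
  intro h
  refine q_pow_ne_one i hi (algebraMap_injective_rationalFunctions ?_)
  rw [map_pow, map_one]
  exact h

variable {L : Type*} [Field L] {φ : ℤ[X][Y] →+* L}

theorem evalsTo_q' : EvalsTo φ q' (φ q) := .of_algebraMap φ q

theorem evalsTo_a' : EvalsTo φ a' (φ a) := .of_algebraMap φ a

theorem evalsTo_deformedSum {g : ℕ → L}
    (hg : ∀ m, EvalsTo φ (qPochhammer q' (q' ^ 2) m / qPochhammer (q' ^ 2) (q' ^ 2) m) (g m))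
    (ha : φ a ≠ 0) (hq : φ q ≠ 1) (hA : ∀ k, φ a * φ q ^ (6 * k + 6) ≠ 1)
    (hB : ∀ k, (φ a)⁻¹ * φ q ^ (6 * k + 6) ≠ 1) (n : ℕ) :
    EvalsTo φ (deformedSum a' q' n)
      ((∑ k ∈ Finset.range n, deformedTerm g (φ a) (φ a)⁻¹ (φ q) k) / (1 - φ q)) := by
  have hQ := evalsTo_q' (φ := φ)
  have hA' := evalsTo_a' (φ := φ)
  have hB' := hA'.inv ha
  have h1 : q' ≠ 1 := by simpa using q'_pow_ne_one 1 one_pos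
  rw [deformedSum_eq_sum_deformedTerm h1]
  refine (EvalsTo.sum _ fun k _ => ?_).div ((EvalsTo.one φ).sub hQ) (sub_ne_zero.mpr hq.symm)
  refine EvalsTo.div ?_ (((hA'.mul (hQ.pow 6)).qPochhammer (hQ.pow 6) k).mul
    ((hB'.mul (hQ.pow 6)).qPochhammer (hQ.pow 6) k)) (mul_ne_zero ?_ ?_)
  · exact (((((hA'.mul hQ).qPochhammer (hQ.pow 2) k).mul ((hB'.mul hQ).qPochhammer (hQ.pow 2) k)).mul
      (hg _)).mul ((EvalsTo.one φ).sub (hQ.pow _))).mul (hQ.pow _)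
  · exact qPochhammer_ne_zero fun i _ => sub_ne_zero.mpr fun h => hA i (by rw [h]; ring)
  · exact qPochhammer_ne_zero fun i _ => sub_ne_zero.mpr fun h => hB i (by rw [h]; ring)

/-- Here the image of `q` is not a root of unity, so no denominator vanishes and the closed form
`deformedSum_pow` applies directly. -/
theorem fracModEq_of_map_eq_pow {n : ℕ} (hn6 : Nat.Coprime n 6) {P : ℤ[X][Y]} (hP : P ≠ 0)
    (hφ : ∀ x, φ x = 0 ↔ P ∣ x) (hq0 : φ q ≠ 0) (hq : ∀ i, 0 < i → φ q ^ i ≠ 1)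
    (ha : φ a = φ q ^ n ∨ φ a = (φ q ^ n)⁻¹) :
    FracModEq P (deformedSum a' q' n)
      (q' ^ (-(((n : ℤ) - 1) / 2)) * qNumber q' n * ((J(-3 | n) : ℤ) : RationalFunctions)) := by
  have hn2 : n % 2 ≠ 0 := fun h => by
    have : 2 ∣ Nat.gcd n 6 := Nat.dvd_gcd (Nat.dvd_of_mod_eq_zero h) (by norm_num)
    rw [hn6] at this
    omega
  have hQ := evalsTo_q' (φ := φ)
  have hq1 : φ q ≠ 1 := by simpa using hq 1 one_pos
  have h1 : ∀ k, φ q ^ n * φ q ^ (6 * k + 6) ≠ 1 := fun k h =>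
    hq (n + (6 * k + 6)) (by omega) (by rw [pow_add, h])
  have h2 : ∀ k, (φ q ^ n)⁻¹ * φ q ^ (6 * k + 6) ≠ 1 := fun k h => by
    have := eq_of_pow_mul_pow_eq_one (inv_mul_cancel₀ hq0) hq (i := 6 * k + 6) (l := n)
      (by rw [mul_comm, inv_pow, h])
    omega
  have hsum : deformedSum (φ a) (φ q) n =
      φ q ^ (-(((n : ℤ) - 1) / 2)) * qNumber (φ q) n * ((J(-3 | n) : ℤ) : L) := by
    rcases ha with h | h
    · rw [h, deformedSum_pow hq0 hq hn6]
    · rw [h, deformedSum_inv, deformedSum_pow hq0 hq hn6]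
  refine EvalsTo.fracModEq hP hφ (v := deformedSum (φ a) (φ q) n) ?_ ?_
  · rw [deformedSum_eq_sum_deformedTerm hq1]
    refine evalsTo_deformedSum (fun m => (hQ.qPochhammer (hQ.pow 2) m).div
      ((hQ.pow 2).qPochhammer (hQ.pow 2) m) ?_) ?_ hq1 ?_ ?_ n
    · exact qPochhammer_ne_zero fun i _ => sub_ne_zero.mpr fun h =>
        hq (2 * i + 2) (by omega) (by rw [h]; ring)
    · rcases ha with h | h <;> rw [h]
      · exact pow_ne_zero _ hq0
      · exact inv_ne_zero (pow_ne_zero _ hq0)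
    · rcases ha with h | h <;> rw [h]
      · exact h1
      · exact h2
    · rcases ha with h | h <;> rw [h]
      · exact h2
      · rw [inv_inv]
        exact h1
  · rw [hsum]
    exact ((hQ.zpow hq0 _).mul (hQ.qNumber n)).mul (EvalsTo.intCast φ _)

/-- Both sides evaluate to 0: the sum by block cancellation, the right-hand side because `[n]`
vanishes. -/
theorem fracModEq_of_isPrimitiveRoot [CharZero L] {n d : ℕ} (hd : 1 < d) (hdn : d ∣ n)
    (hn6 : Nat.Coprime n 6) {P : ℤ[X][Y]} (hP : P ≠ 0)
    (hφ : ∀ x, φ x = 0 ↔ P ∣ x) (hζ : IsPrimitiveRoot (φ q) d) (ha0 : φ a ≠ 0)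
    (ha : ∀ z, z ^ d = 1 → φ a * z ≠ 1) :
    FracModEq P (deformedSum a' q' n)
      (q' ^ (-(((n : ℤ) - 1) / 2)) * qNumber q' n * ((J(-3 | n) : ℤ) : RationalFunctions)) := by
  have hd6 : Nat.Coprime d 6 := Nat.Coprime.coprime_dvd_left hdn hn6
  have hd2 : d % 2 ≠ 0 := fun h => by
    have : 2 ∣ Nat.gcd d 6 := Nat.dvd_gcd (Nat.dvd_of_mod_eq_zero h) (by norm_num)
    rw [hd6] at this
    omega
  have hQ := evalsTo_q' (φ := φ)
  have hq0 : φ q ≠ 0 := hζ.ne_zero (by omega)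
  have hq1 : φ q ≠ 1 := hζ.ne_one hd
  have hζd : ∀ i, (φ q ^ i) ^ d = 1 := fun i => by
    rw [← pow_mul, mul_comm, pow_mul, hζ.pow_eq_one, one_pow]
  have hb : ∀ z, z ^ d = 1 → (φ a)⁻¹ * z ≠ 1 := fun z hz h => by
    refine ha z⁻¹ (by rw [inv_pow, hz, inv_one]) ?_
    rw [← inv_inj, mul_inv, inv_inv, h, inv_one]
  choose B hB using exists_central_ratio q_pow_ne_one
  have hinj := algebraMap_injective_rationalFunctions
  -- No power of a root of unity of odd order equals `-1`.
  have hD : ∀ m, φ (qPochhammer (-q) q m ^ 2) ≠ 0 := fun m => by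
    rw [map_pow, map_qPochhammer, map_neg]
    refine pow_ne_zero _ (qPochhammer_ne_zero fun i _ h => ?_)
    have h1 : φ q ^ (i + 1) = -1 := by linear_combination h
    have h2 := hζd (i + 1)
    rw [h1, Odd.neg_one_pow (Nat.odd_iff.mpr (by omega))] at h2
    norm_num at h2
  have hG0 : ∀ m, qPochhammer (q' ^ 2) (q' ^ 2) m ≠ 0 := fun m =>
    qPochhammer_ne_zero fun i _ => sub_ne_zero.mpr fun h =>
      q'_pow_ne_one (2 * i + 2) (by omega) (by rw [h]; ring)
  have hG : ∀ m, qPochhammer q' (q' ^ 2) m / qPochhammer (q' ^ 2) (q' ^ 2) m =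
      algebraMap _ RationalFunctions (B m) /
        algebraMap _ RationalFunctions (qPochhammer (-q) q m ^ 2) := fun m => by
    have h := congrArg (algebraMap _ RationalFunctions) (hB m)
    rw [map_mul, map_mul, map_qPochhammer, map_qPochhammer, map_pow] at h
    rw [div_eq_div_iff (hG0 m) (algebraMap_ne_zero_of_map_ne_zero (hD m))]
    exact h.symm
  -- The recurrence is proved before specialisation, where `(q²; q²)_m` can still be cancelled.
  have hrec : ∀ m, B (m + 1) * qPochhammer (-q) q m ^ 2 * (1 - q ^ (2 * m + 2)) =
      B m * qPochhammer (-q) q (m + 1) ^ 2 * (1 - q ^ (2 * m + 1)) := fun m => by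
    have h1 := hB m
    have h2 := hB (m + 1)
    have h0 : qPochhammer (q ^ 2) (q ^ 2) m ≠ 0 := qPochhammer_ne_zero fun i _ =>
      sub_ne_zero.mpr fun h => q_pow_ne_one (2 * i + 2) (by omega) (by rw [h]; ring)
    refine mul_right_cancel₀ h0 ?_
    rw [qPochhammer_succ, qPochhammer_succ q] at h2
    generalize qPochhammer (q ^ 2) (q ^ 2) m = x at *
    generalize qPochhammer (-q) q m = y at *
    generalize qPochhammer (-q) q (m + 1) = z at *
    generalize qPochhammer q (q ^ 2) m = w at *
    linear_combination y ^ 2 * h2 - z ^ 2 * (1 - q ^ (2 * m + 1)) * h1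
  set g : ℕ → L := fun m => φ (B m) / φ (qPochhammer (-q) q m ^ 2) with hgdef
  have hg : ∀ m, g (m + 1) * (1 - φ q ^ (2 * m + 2)) = g m * (1 - φ q ^ (2 * m + 1)) := fun m => by
    have h := congrArg φ (hrec m)
    have h1 := hD m
    have h2 := hD (m + 1)
    simp only [hgdef]
    simp only [map_mul, map_sub, map_one, map_pow φ q] at h
    generalize φ (qPochhammer (-q) q m ^ 2) = y at *
    generalize φ (qPochhammer (-q) q (m + 1) ^ 2) = z at *
    field_simp
    linear_combination h
  obtain ⟨e, rfl⟩ := hdn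
  refine EvalsTo.fracModEq hP hφ (v := 0) ?_ ?_
  · have h := evalsTo_deformedSum (φ := φ) (g := g)
      (fun m => by
        rw [hG m]
        exact (EvalsTo.of_algebraMap φ _).div (.of_algebraMap φ _) (hD m))
      ha0 hq1 (fun k => ha _ (hζd _)) (fun k => hb _ (hζd _)) (d * e)
    rwa [sum_deformedTerm_eq_zero (mul_inv_cancel₀ ha0) hζ hd hd6 ha hb hg, zero_div] at h
  · have h : qNumber (φ q) (d * e) = 0 := by
      rw [qNumber_eq_div hq1, pow_mul, hζ.pow_eq_one, one_pow, sub_self, zero_div]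
    have h' := ((hQ.zpow hq0 (-((((d * e : ℕ) : ℤ) - 1) / 2))).mul (hQ.qNumber (d * e))).mul
      (EvalsTo.intCast φ J(-3 | d * e))
    rwa [h, mul_zero, zero_mul] at h'

end Congruences

/-! ### The specialisations, their kernels, and the final assembly. -/

section Homomorphisms

open Polynomial

/-- The homomorphism `ℤ[q][a] → ℂ(a)` that sends `q` to the complex number `ζ`. -/
noncomputable def evalAtComplex (ζ : ℂ) : ℤ[X][Y] →+* FractionRing ℂ[X] :=
  (algebraMap ℂ[X] (FractionRing ℂ[X])).comp
    (mapRingHom (eval₂RingHom (Int.castRingHom ℂ) ζ))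

theorem evalAtComplex_q (ζ : ℂ) :
    evalAtComplex ζ TwoIndeterminates.q = algebraMap ℂ[X] (FractionRing ℂ[X]) (C ζ) := by
  simp [evalAtComplex, TwoIndeterminates.q]

theorem evalAtComplex_a (ζ : ℂ) :
    evalAtComplex ζ TwoIndeterminates.a = algebraMap ℂ[X] (FractionRing ℂ[X]) X := by
  simp [evalAtComplex, TwoIndeterminates.a]

/-- Taking `d`-th powers would give `a^d = 1` for the indeterminate `a`. -/
theorem evalAtComplex_a_mul_ne_one (ζ : ℂ) {d : ℕ} (hd : 0 < d) (z : FractionRing ℂ[X])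
    (hz : z ^ d = 1) : evalAtComplex ζ TwoIndeterminates.a * z ≠ 1 := by
  intro h
  have h' := congrArg (· ^ d) h
  simp only [mul_pow, hz, mul_one, one_pow, evalAtComplex_a, ← map_pow] at h'
  rw [← map_one (algebraMap ℂ[X] (FractionRing ℂ[X]))] at h'
  have := congrArg natDegree (IsFractionRing.injective ℂ[X] (FractionRing ℂ[X]) h')
  rw [natDegree_X_pow, natDegree_one] at this
  omega

/-- Coefficientwise in `a`: an integer polynomial vanishes at `ζ` exactly when its minimal
polynomial `Φ_d` divides it over `ℤ`. -/
theorem evalAtComplex_eq_zero_iff {ζ : ℂ} {d : ℕ} (hζ : IsPrimitiveRoot ζ d) (hd : 0 < d)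
    (x : ℤ[X][Y]) : evalAtComplex ζ x = 0 ↔ C (cyclotomic d ℤ) ∣ x := by
  have hinj := IsFractionRing.injective ℂ[X] (FractionRing ℂ[X])
  rw [evalAtComplex, RingHom.comp_apply, map_eq_zero_iff _ hinj, C_dvd_iff_dvd_coeff,
    cyclotomic_eq_minpoly hζ hd, Polynomial.ext_iff]
  refine forall_congr' fun i => ?_
  rw [coe_mapRingHom, coeff_map, coeff_zero, coe_eval₂RingHom]
  rw [← minpoly.isIntegrallyClosed_dvd_iff (hζ.isIntegral hd), aeval_def]
  rfl

/-- The homomorphism `ℤ[q][a] → ℚ(q)` that sends `a` to `v`. -/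
noncomputable def evalAtFraction (v : FractionRing ℤ[X]) : ℤ[X][Y] →+* FractionRing ℤ[X] :=
  eval₂RingHom (algebraMap ℤ[X] (FractionRing ℤ[X])) v

theorem evalAtFraction_q (v : FractionRing ℤ[X]) :
    evalAtFraction v TwoIndeterminates.q = algebraMap ℤ[X] (FractionRing ℤ[X]) X := by
  simp [evalAtFraction, TwoIndeterminates.q]

theorem evalAtFraction_a (v : FractionRing ℤ[X]) : evalAtFraction v TwoIndeterminates.a = v := by
  simp [evalAtFraction, TwoIndeterminates.a]

theorem algebraMap_X_pow_ne_one (i : ℕ) (hi : 0 < i) :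
    algebraMap ℤ[X] (FractionRing ℤ[X]) X ^ i ≠ 1 := by
  intro h
  rw [← map_pow, ← map_one (algebraMap ℤ[X] (FractionRing ℤ[X]))] at h
  have := congrArg natDegree (IsFractionRing.injective ℤ[X] (FractionRing ℤ[X]) h)
  rw [natDegree_X_pow, natDegree_one] at this
  omega

theorem algebraMap_X_ne_zero : algebraMap ℤ[X] (FractionRing ℤ[X]) X ≠ 0 :=
  (map_ne_zero_iff _ (IsFractionRing.injective _ _)).mpr X_ne_zero

theorem evalAtFraction_pow_eq_zero_iff (n : ℕ) (x : ℤ[X][Y]) :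
    evalAtFraction (algebraMap ℤ[X] (FractionRing ℤ[X]) X ^ n) x = 0 ↔
      TwoIndeterminates.a - TwoIndeterminates.q ^ n ∣ x := by
  rw [TwoIndeterminates.a, TwoIndeterminates.q, ← C_pow, dvd_iff_isRoot, evalAtFraction, ← map_pow,
    coe_eval₂RingHom, eval₂_at_apply, map_eq_zero_iff _ (IsFractionRing.injective _ _)]
  rfl

theorem evalAtFraction_inv_pow_eq_zero_iff (n : ℕ) (x : ℤ[X][Y]) :
    evalAtFraction ((algebraMap ℤ[X] (FractionRing ℤ[X]) X ^ n)⁻¹) x = 0 ↔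
      1 - TwoIndeterminates.a * TwoIndeterminates.q ^ n ∣ x := by
  set s := algebraMap ℤ[X] (FractionRing ℤ[X]) X with hs
  have hs0 : s ^ n ≠ 0 := pow_ne_zero _ algebraMap_X_ne_zero
  constructor
  · intro h
    -- The constant coefficient in `a` is 1, so the polynomial is primitive and Gauss's lemma
    -- descends divisibility from the fraction field.
    have hprim : (1 - TwoIndeterminates.a * TwoIndeterminates.q ^ n).IsPrimitive := by
      intro r hr
      rw [C_dvd_iff_dvd_coeff] at hr
      have := hr 0
      rw [TwoIndeterminates.a, coeff_sub, coeff_X_mul_zero, coeff_one_zero, sub_zero] at this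
      exact isUnit_of_dvd_one this
    refine hprim.dvd_of_fraction_map_dvd_fraction_map (K := FractionRing ℤ[X]) ?_
    have h1 : (1 - TwoIndeterminates.a * TwoIndeterminates.q ^ n).map
        (algebraMap ℤ[X] (FractionRing ℤ[X])) = C (-s ^ n) * (X - C ((s ^ n)⁻¹)) := by
      rw [mul_sub, ← C_mul, neg_mul, mul_inv_cancel₀ hs0]
      simp [TwoIndeterminates.a, TwoIndeterminates.q, hs]
      ring
    rw [h1]
    refine (IsUnit.mul_left_dvd (isUnit_C.mpr (neg_ne_zero.mpr hs0).isUnit)).mpr ?_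
    rw [dvd_iff_isRoot, IsRoot.def, eval_map]
    exact h
  · rintro ⟨y, rfl⟩
    rw [map_mul, map_sub, map_one, map_mul, map_pow, evalAtFraction_a, evalAtFraction_q,
      inv_mul_cancel₀ hs0, sub_self, zero_mul]

theorem fracModEq_deformedSum (n : ℕ) (hn : 0 < n) (hn6 : Nat.Coprime n 6) :
    FracModEq
      (qNumber TwoIndeterminates.q n *
        (1 - TwoIndeterminates.a * TwoIndeterminates.q ^ n) *
        (TwoIndeterminates.a - TwoIndeterminates.q ^ n))
      (deformedSum TwoIndeterminates.a' TwoIndeterminates.q' n)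
      (TwoIndeterminates.q' ^ (-(((n : ℤ) - 1) / 2)) * qNumber TwoIndeterminates.q' n *
        ((J(-3 | n) : ℤ) : TwoIndeterminates.RationalFunctions)) := by
  set s := algebraMap ℤ[X] (FractionRing ℤ[X]) X with hs
  have hs0 : s ≠ 0 := algebraMap_X_ne_zero
  have hs1 : ∀ i, 0 < i → s ^ i ≠ 1 := algebraMap_X_pow_ne_one
  have hP₁ : 1 - TwoIndeterminates.a * TwoIndeterminates.q ^ n ≠ 0 := fun h => by
    have := congrArg (evalAtFraction 0) h
    simp [evalAtFraction_a] at this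
  have hP₂ : TwoIndeterminates.a - TwoIndeterminates.q ^ n ≠ 0 := fun h => by
    have := congrArg (evalAtFraction 0) h
    simp [evalAtFraction_a, evalAtFraction_q, ← hs, hs0] at this
  have hcyc : ∀ d, C (cyclotomic d ℤ) ≠ 0 := fun d => C_ne_zero.mpr (cyclotomic_ne_zero d ℤ)
  have hinjC := IsFractionRing.injective ℂ[X] (FractionRing ℂ[X])
  have hex : ∀ d : ℕ, ∃ z : ℂ, 0 < d → IsPrimitiveRoot z d :=
    fun d => ⟨_, fun hd => Complex.isPrimitiveRoot_exp d hd.ne'⟩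
  choose ζ hζ using hex
  have hN : qNumber TwoIndeterminates.q n =
      ∏ d ∈ n.divisors.erase 1, C (cyclotomic d ℤ) := by
    rw [← map_prod, prod_cyclotomic_eq_geom_sum hn, map_sum]
    simp [qNumber, TwoIndeterminates.q]
  have hmem : ∀ d ∈ n.divisors.erase 1, 1 < d ∧ d ∣ n := fun d hd => by
    rw [Finset.mem_erase, Nat.mem_divisors] at hd
    have := Nat.pos_of_dvd_of_pos hd.2.1 hn
    exact ⟨by omega, hd.2.1⟩
  have hrel : ∀ d, 0 < d → ∀ y, evalAtComplex (ζ d) y ≠ 0 →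
      IsRelPrime (C (cyclotomic d ℤ)) y := fun d hd y hy =>
    isRelPrime_of_map_ne_zero (hcyc d) (evalAtComplex_eq_zero_iff (hζ d hd) hd) hy
  have hqd : ∀ d, 0 < d →
      evalAtComplex (ζ d) TwoIndeterminates.q ^ d = 1 :=
    fun d hd => by
      rw [evalAtComplex_q, ← map_pow, ← C_pow, (hζ d hd).pow_eq_one, C_1, map_one]
  have hqn : ∀ d, 0 < d → d ∣ n →
      evalAtComplex (ζ d) TwoIndeterminates.q ^ n = 1 := by
    rintro d hd ⟨e, rfl⟩
    rw [pow_mul, hqd d hd, one_pow]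
  rw [hN]
  refine ((FracModEq.prod (fun d hd => ?_) fun d hd d' hd' hne => ?_).mul ?_ ?_).mul ?_ ?_
  · obtain ⟨h1, h2⟩ := hmem d hd
    have hd0 : 0 < d := by omega
    refine fracModEq_of_isPrimitiveRoot
      (φ := evalAtComplex (ζ d)) h1 h2 hn6 (hcyc d)
      (evalAtComplex_eq_zero_iff (hζ d hd0) hd0) ?_ ?_ (evalAtComplex_a_mul_ne_one _ hd0)
    · rw [evalAtComplex_q]
      exact ((hζ d hd0).map_of_injective C_injective).map_of_injective hinjC
    · rw [evalAtComplex_a]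
      exact (map_ne_zero_iff _ hinjC).mpr X_ne_zero
  · obtain ⟨h1, -⟩ := hmem d hd
    obtain ⟨h1', -⟩ := hmem d' hd'
    refine hrel d (by omega) _ fun h => ?_
    rw [evalAtComplex_eq_zero_iff (hζ d (by omega)) (by omega)] at h
    have h := (C_dvd_iff_dvd_coeff _ _).mp h 0
    rw [coeff_C_zero] at h
    have hd0 : 0 < d := by omega
    have hd0' : 0 < d' := by omega
    have hass := (cyclotomic.irreducible hd0).associated_of_dvd (cyclotomic.irreducible hd0') h
    exact hne (cyclotomic_injective (R := ℤ)
      (eq_of_monic_of_associated (cyclotomic.monic d ℤ) (cyclotomic.monic d' ℤ) hass))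
  · refine fracModEq_of_map_eq_pow (φ := evalAtFraction ((s ^ n)⁻¹)) hn6 hP₁
      (evalAtFraction_inv_pow_eq_zero_iff n) ?_ ?_ (Or.inr ?_)
    · rwa [evalAtFraction_q]
    · rwa [evalAtFraction_q]
    · rw [evalAtFraction_q, evalAtFraction_a]
  · refine IsRelPrime.prod_left fun d hd => ?_
    obtain ⟨h1, h2⟩ := hmem d hd
    refine hrel d (by omega) _ ?_
    -- Under `q ↦ ζ` one has `q^n ↦ 1`, so the factor becomes `1 - a`, which is nonzero.
    rw [map_sub, map_one, map_mul, map_pow, hqn d (by omega) h2]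
    exact sub_ne_zero.mpr (evalAtComplex_a_mul_ne_one _ (d := d) (by omega) 1 (one_pow d)).symm
  · refine fracModEq_of_map_eq_pow (φ := evalAtFraction (s ^ n)) hn6 hP₂
      (evalAtFraction_pow_eq_zero_iff n) ?_ ?_ (Or.inl ?_)
    · rwa [evalAtFraction_q]
    · rwa [evalAtFraction_q]
    · rw [evalAtFraction_q, evalAtFraction_a]
  · refine IsRelPrime.mul_left (IsRelPrime.prod_left fun d hd => ?_) ?_
    · obtain ⟨h1, h2⟩ := hmem d hd
      refine hrel d (by omega) _ ?_
      rw [map_sub, map_pow, hqn d (by omega) h2]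
      have := evalAtComplex_a_mul_ne_one (ζ d) (d := d)
        (by omega) 1 (one_pow d)
      rw [mul_one] at this
      exact sub_ne_zero.mpr this
    · refine isRelPrime_of_map_ne_zero hP₁ (evalAtFraction_inv_pow_eq_zero_iff n) ?_
      rw [map_sub, map_pow, evalAtFraction_a, evalAtFraction_q, ← hs]
      -- If `a - q^n` vanished at `a = q^(-n)`, then `q^(2n) = 1`.
      refine sub_ne_zero.mpr fun h => hs1 (n + n) (by omega) ?_
      rw [pow_add]
      nth_rw 1 [← h]
      exact inv_mul_cancel₀ (pow_ne_zero n hs0)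

end Homomorphisms

theorem theorem5 (n : ℕ) (hn : 0 < n) (hn6 : Nat.Coprime n 6) :
    FracModEq
      (qNumber TwoIndeterminates.q n *
        (1 - TwoIndeterminates.a * TwoIndeterminates.q ^ n) *
        (TwoIndeterminates.a - TwoIndeterminates.q ^ n))
      (deformedSum TwoIndeterminates.a' TwoIndeterminates.q' n)
      (TwoIndeterminates.q' ^ (-(((n : ℤ) - 1) / 2)) * qNumber TwoIndeterminates.q' n *
        ((J(-3 | n) : ℤ) : TwoIndeterminates.RationalFunctions)) :=
  fracModEq_deformedSum n hn hn6
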